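/- Assume the Continuum Hypothesis. Let $(L_t)_{t\in\omega}$ be a sequence of finite linear orders and $D$ an ultrafilter on $\omega$ such that the ultraproduct $\mathfrak L^*=\prod_{t\in\omega}L_t/D$ is infinite. Let $\mathfrak E$ (with underlying set $E$) be the $\aleph_1$-saturated dense linear order without endpoints of cardinality $\aleph_1$ (unique up to isomorphism), so that $|E|=\mathfrak c$. Automorphism groups of linear orders carry the topology of pointwise convergence (the orders being discrete), and $\mathbb Z^{\mathfrak c}=\mathbb Z^{E}$ carries the product topology with $\mathbb Z$ discrete. Let $\mathrm{Aut}(\mathfrak E)$ act on $\mathbb Z^{E}$ by permuting coordinates, $(\varphi\cdot f)(e)=f(\varphi^{-1}(e))$, and give $\mathrm{Aut}(\mathfrak E)\ltimes\mathbb Z^{E}$ the product topology. For a topological group $G$, a minimal $G$-flow is a nonempty compact Hausdorff space $X$ with a jointly continuous action of $G$ such that $X$ has no nonempty proper closed $G$-invariant subset. A universal minimal flow $M(G)$ is a minimal $G$-flow such that for every minimal $G$-flow $Y$ there is a continuous $G$-equivariant surjection $M(G)\to Y$. Then there is an isomorphism of topological groups $$\mathrm{Aut}(\mathfrak L^*)\;\cong\;\mathrm{Aut}(\mathfrak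 E)\ltimes\mathbb Z^{\mathfrak c}$$ such that, with $\mathbb Z^{\mathfrak c}$ regarded as a subgroup of $\mathrm{Aut}(\mathfrak L^*)$ through it, $M(\mathrm{Aut}(\mathfrak L^*))\cong M(\mathbb Z^{\mathfrak c})$: both groups have universal minimal flows, and for any universal minimal flow $X$ of $\mathrm{Aut}(\mathfrak L^*)$ and any universal minimal flow $Y$ of $\mathbb Z^{\mathfrak c}$ there is a homeomorphism $X\to Y$ that is $\mathbb Z^{\mathfrak c}$-equivariant. -/

import Mathlib

open Cardinal Topology
open scoped FirstOrder

universe u v w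

namespace PseudofiniteOrder

/-! ### Ultraproducts of linear orders -/

/-- The ultraproduct of the sequence `L` modulo the ultrafilter `D` over `ℕ`. -/
def Ultraproduct (D : Ultrafilter ℕ) (L : ℕ → Type u) : Type u :=
  (D : Filter ℕ).Product L

/-- The order of an ultraproduct: `[a] ≤ [b]` iff `a t ≤ b t` for `D`-almost all `t`. -/
instance Ultraproduct.instLE (D : Ultrafilter ℕ) (L : ℕ → Type u) [∀ t, LinearOrder (L t)] :
    LE (Ultraproduct D L) where
  le := Quotient.lift₂ (fun a b : ∀ t, L t => ∀ᶠ t in (D : Filter ℕ), a t ≤ b t) (by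
    intro a b a' b' (ha : ∀ᶠ t in (D : Filter ℕ), a t = a' t)
      (hb : ∀ᶠ t in (D : Filter ℕ), b t = b' t)
    refine propext ⟨fun h => ?_, fun h => ?_⟩
    · filter_upwards [ha, hb, h] with t h1 h2 h3
      rwa [← h1, ← h2]
    · filter_upwards [ha, hb, h] with t h1 h2 h3
      rwa [h1, h2])

noncomputable instance Ultraproduct.instLinearOrder (D : Ultrafilter ℕ) (L : ℕ → Type u)
    [∀ t, LinearOrder (L t)] : LinearOrder (Ultraproduct D L) where
  le_refl := by
    rintro ⟨a⟩
    exact Filter.Eventually.of_forall fun t => le_refl (a t)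
  le_trans := by
    rintro ⟨a⟩ ⟨b⟩ ⟨c⟩ h1 h2
    exact (Filter.Eventually.and h1 h2).mono fun t h => h.1.trans h.2
  le_antisymm := by
    rintro ⟨a⟩ ⟨b⟩ h1 h2
    exact Quotient.sound ((Filter.Eventually.and h1 h2).mono fun t h => le_antisymm h.1 h.2)
  le_total := by
    rintro ⟨a⟩ ⟨b⟩
    exact Ultrafilter.eventually_or.1 (Filter.Eventually.of_forall fun t => le_total (a t) (b t))
  toDecidableLE := Classical.decRel _

/-! ### Saturation -/

/-- `M` is `κ`-saturated: whenever `p` is a set of formulas in one free variable with parameters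
from a set `B ⊆ M` of cardinality less than `κ`, and `p` is finitely satisfiable in `M`, then `p`
is realized in `M`. -/
def IsSaturated (𝓛 : FirstOrder.Language.{v, w}) (κ : Cardinal.{u}) (M : Type u)
    [𝓛.Structure M] : Prop :=
  ∀ B : Set M, #B < κ → ∀ p : Set (𝓛[[B]].Formula (Fin 1)),
    (∀ q : Finset (𝓛[[B]].Formula (Fin 1)), (q : Set (𝓛[[B]].Formula (Fin 1))) ⊆ p →
      ∃ a : M, ∀ φ ∈ q, φ.Realize (fun _ => a)) →
    ∃ a : M, ∀ φ ∈ p, φ.Realize (fun _ => a)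

/-- A linear order is `κ`-saturated if it is so as a structure in the language `{≤}`. -/
def IsSaturatedOrder (κ : Cardinal.{u}) (M : Type u) [LinearOrder M] : Prop :=
  letI := FirstOrder.Language.orderStructure M
  IsSaturated FirstOrder.Language.order κ M

/-! ### Automorphism groups of linear orders as topological groups -/

/-- The automorphism group of a linear order. -/
abbrev Aut (M : Type u) [LinearOrder M] : Type u := M ≃o M

/-- The topology of pointwise convergence on `Aut(M)`, where `M` is discrete. -/
instance autTopology (M : Type u) [LinearOrder M] : TopologicalSpace (Aut M) :=
  TopologicalSpace.induced (fun f : Aut M => (f : M → M))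
    (@Pi.topologicalSpace M (fun _ => M) (fun _ => ⊥))

instance autTopologicalGroup (M : Type u) [LinearOrder M] : IsTopologicalGroup (Aut M) := by
  let _ : TopologicalSpace M := ⊥
  have : DiscreteTopology M := ⟨rfl⟩
  have hev : ∀ a : M, Continuous fun f : M ≃o M => f a := fun a =>
    (continuous_apply a).comp continuous_induced_dom
  have hloc : ∀ (f : M ≃o M) (a : M), ∀ᶠ g in 𝓝 f, g a = f a := fun f a =>
    (hev a).continuousAt.eventually ((isOpen_discrete {f a}).mem_nhds rfl)
  refine { continuous_mul := ?_, continuous_inv := ?_ }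
  · refine continuous_induced_rng.2 (continuous_pi fun a => ?_)
    refine continuous_iff_continuousAt.2 fun ⟨f, g⟩ => ?_
    have h1 : ∀ᶠ x : (M ≃o M) × (M ≃o M) in 𝓝 (f, g), x.1 (g a) = f (g a) :=
      (continuous_fst.tendsto (f, g)).eventually (hloc f (g a))
    have h2 : ∀ᶠ x : (M ≃o M) × (M ≃o M) in 𝓝 (f, g), x.2 a = g a :=
      (continuous_snd.tendsto (f, g)).eventually (hloc g a)
    refine (continuousAt_const (y := f (g a))).congr ?_
    filter_upwards [h1, h2] with x hx1 hx2
    change f (g a) = x.1 (x.2 a)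
    rw [hx2, hx1]
  · refine continuous_induced_rng.2 (continuous_pi fun a => ?_)
    refine continuous_iff_continuousAt.2 fun f => ?_
    refine (continuousAt_const (y := f.symm a)).congr ?_
    filter_upwards [hloc f (f.symm a)] with g hg
    change f.symm a = g.symm a
    rw [OrderIso.eq_symm_apply, hg, OrderIso.apply_symm_apply]

/-! ### The semidirect product -/

/-- `Aut(E)` acts on the group `ℤ^E` by permuting the coordinates,
`(φ · f)(e) = f (φ⁻¹ e)`. -/
def permuteCoordinates (E : Type u) [LinearOrder E] :
    Aut E →* MulAut (E → Multiplicative ℤ) where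
  toFun φ :=
    { toFun := fun f e => f (φ.symm e)
      invFun := fun f e => f (φ e)
      left_inv := fun f => funext fun e => congrArg f (φ.symm_apply_apply e)
      right_inv := fun f => funext fun e => congrArg f (φ.apply_symm_apply e)
      map_mul' := fun _ _ => rfl }
  map_one' := rfl
  map_mul' _ _ := rfl

/-- The topology of a semidirect product: the product topology of its two factors. -/
instance semidirectTopology {N : Type u} {H : Type v} [Group N] [Group H]
    [TopologicalSpace N] [TopologicalSpace H] (α : H →* MulAut N) :
    TopologicalSpace (N ⋊[α] H) :=
  TopologicalSpace.induced (fun x : N ⋊[α] H => (x.left, x.right)) inferInstance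

/-! ### Universal minimal flows -/

/-- The action of the topological group `G` on the space `X` is a minimal flow: `X` is a nonempty
compact Hausdorff space, the action is jointly continuous, and every orbit is dense (that is, `X`
has no nonempty proper closed invariant subset). -/
structure IsMinimalFlow (G : Type u) [Group G] [TopologicalSpace G] [IsTopologicalGroup G]
    (X : Type v) [TopologicalSpace X] [MulAction G X] : Prop where
  compactSpace : CompactSpace X
  t2Space : T2Space X
  nonempty : Nonempty X
  continuousSMul : ContinuousSMul G X
  minimal : MulAction.IsMinimal G X

/-- `X` is a universal minimal flow of `G`: it is a minimal flow, and every minimal flow `Y` of `G`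
is a quotient of `X`. -/
structure IsUniversalMinimalFlow (G : Type u) [Group G] [TopologicalSpace G]
    [IsTopologicalGroup G] (X : Type u) [TopologicalSpace X] [MulAction G X] : Prop where
  isMinimalFlow : IsMinimalFlow G X
  universal : ∀ (Y : Type u) [TopologicalSpace Y] [MulAction G Y], IsMinimalFlow G Y →
    ∃ π : X → Y, Continuous π ∧ (∀ (g : G) (x : X), π (g • x) = g • π x) ∧ Function.Surjective π

end PseudofiniteOrder

open PseudofiniteOrder

/-! Write `K = ℤ ^ E`, `H = Aut E`, and call a point of the ultraproduct interior if it is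
infinitely far from both ends.

The group. Lying at finite distance is an equivalence relation, and each class of interior points is
a copy of `ℤ`. Saturation of the ultraproduct makes the order of these classes an `η₁` order. It has
size at most `𝔠 = ℵ₁`, so it is isomorphic to `E` by back-and-forth
(`IsPartialIso.exists_orderIso`). Hence the interior is the lexicographic product `E × ℤ`
(`exists_isChainSum`). A point outside it is determined by a finite number of predecessors or
successors, so every automorphism fixes it. An automorphism is thus a permutation in `H` together
with a shift on each copy of `ℤ`, which gives the semidirect product, topologically as well
(`IsChainSum.autEquiv`).

The flows. By Ramsey's theorem `H` is extremely amenable, and so is the stabilizer of a closed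
initial segment (`exists_fixed_point`). `H` acts on the greatest ambit of `K` and fixes its base
point. Let `X` be a minimal subset of this ambit for `K ⋊ H`. A flow `Y` of `K ⋊ H` has an `H`-fixed
point; sending the base point there extends to an equivariant map on the ambit, and so `X` maps onto
every minimal `Y`. The same extension property maps `X` onto every minimal flow of `K`.

The heart is that `X` is already minimal for `K` (`IsMinimalInvariantSet.eq_of_smul_mem`). A clopen
set is supported on a finite set `F` of coordinates. One passes from `X` to smaller sets, minimal
for `K` and the stabilizers of longer and longer initial segments, adding one point of `F` at a
time. Once `F` lies in the segment the claim is immediate, and `inter_nonempty` transfers it back.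

Finally, `K`-endomorphisms of `X` are injective by an Ellis semigroup argument
(`Ambit.injOn_of_minimal`), so any universal minimal flow of either group is homeomorphic to `X`. -/

namespace PseudofiniteOrder

/-! ### Orders of type `η₁` and back-and-forth -/

section EtaOne

variable {M N : Type u} [LinearOrder M] [LinearOrder N]

/-- Any two countable sets `A < B` are separated by a point strictly between them. -/
def IsEtaOne (M : Type u) [LinearOrder M] : Prop :=
  ∀ A B : Set M, A.Countable → B.Countable → (∀ a ∈ A, ∀ b ∈ B, a < b) →
    ∃ x, (∀ a ∈ A, a < x) ∧ ∀ b ∈ B, x < b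

/-- The conditions `a < x` and `x < b` form a type over the countable set `A ∪ B`. Each finite part
involves finite subsets of `A` and `B` only, and is satisfiable by density and the absence of
endpoints. -/
theorem IsSaturatedOrder.isEtaOne [Nonempty M] [DenselyOrdered M] [NoMinOrder M] [NoMaxOrder M]
    (h : IsSaturatedOrder ℵ₁ M) : IsEtaOne M := by
  classical
  intro A B hA hB hAB
  let _ := FirstOrder.Language.orderStructure M
  let C : Set M := A ∪ B
  have hC : #C < ℵ₁ := lt_of_le_of_lt (Cardinal.mk_le_aleph0_iff.2 (hA.union hB))
    Cardinal.aleph0_lt_aleph_one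
  let leC : (FirstOrder.Language.order[[C]]).Relations 2 := Sum.inl FirstOrder.Language.orderRel.le
  let x : (FirstOrder.Language.order[[C]]).Term (Fin 1) := FirstOrder.Language.Term.var 0
  let lo : C → (FirstOrder.Language.order[[C]]).Formula (Fin 1) := fun c =>
    ∼(leC.formula₂ x (FirstOrder.Language.Constants.term (FirstOrder.Language.order.con c)))
  let hi : C → (FirstOrder.Language.order[[C]]).Formula (Fin 1) := fun c =>
    ∼(leC.formula₂ (FirstOrder.Language.Constants.term (FirstOrder.Language.order.con c)) x)
  have hlo : ∀ (c : C) (a : M), (lo c).Realize (fun _ => a) ↔ c.1 < a := by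
    intro c a
    simp only [lo, FirstOrder.Language.Formula.realize_not, FirstOrder.Language.Formula.realize_rel₂]
    rw [← not_le]
    refine not_congr ?_
    simp only [x, FirstOrder.Language.Term.realize_constants, FirstOrder.Language.Term.realize_var]
    exact Iff.rfl
  have hhi : ∀ (c : C) (a : M), (hi c).Realize (fun _ => a) ↔ a < c.1 := by
    intro c a
    simp only [hi, FirstOrder.Language.Formula.realize_not, FirstOrder.Language.Formula.realize_rel₂]
    rw [← not_le]
    refine not_congr ?_
    simp only [x, FirstOrder.Language.Term.realize_constants, FirstOrder.Language.Term.realize_var]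
    exact Iff.rfl
  obtain ⟨a, ha⟩ := h C hC {φ | (∃ c : C, c.1 ∈ A ∧ φ = lo c) ∨ ∃ c : C, c.1 ∈ B ∧ φ = hi c} (by
    intro q hq
    have key : ∀ q : Finset ((FirstOrder.Language.order[[C]]).Formula (Fin 1)),
        (q : Set ((FirstOrder.Language.order[[C]]).Formula (Fin 1))) ⊆
          {φ | (∃ c : C, c.1 ∈ A ∧ φ = lo c) ∨ ∃ c : C, c.1 ∈ B ∧ φ = hi c} →
        ∃ l r : Finset M, (∀ a ∈ l, a ∈ A) ∧ (∀ b ∈ r, b ∈ B) ∧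
          ∀ z, (∀ a ∈ l, a < z) → (∀ b ∈ r, z < b) → ∀ φ ∈ q, φ.Realize (fun _ => z) := by
      intro q
      induction q using Finset.induction_on with
      | empty => exact fun _ => ⟨∅, ∅, by simp⟩
      | insert φ q _ ih =>
        intro hq
        rw [Finset.coe_insert, Set.insert_subset_iff] at hq
        obtain ⟨l, r, hl, hr, hz⟩ := ih hq.2
        rcases hq.1 with ⟨c, hc, rfl⟩ | ⟨c, hc, rfl⟩
        · refine ⟨insert c.1 l, r, by simpa [hc] using hl, hr, fun z h1 h2 φ hφ => ?_⟩
          simp only [Finset.mem_insert, forall_eq_or_imp] at h1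
          rcases Finset.mem_insert.1 hφ with rfl | hφ
          · exact (hlo c z).2 h1.1
          · exact hz z h1.2 h2 φ hφ
        · refine ⟨l, insert c.1 r, hl, by simpa [hc] using hr, fun z h1 h2 φ hφ => ?_⟩
          simp only [Finset.mem_insert, forall_eq_or_imp] at h2
          rcases Finset.mem_insert.1 hφ with rfl | hφ
          · exact (hhi c z).2 h2.1
          · exact hz z h1 h2.2 φ hφ
    obtain ⟨l, r, hl, hr, hz⟩ := key q hq
    obtain ⟨z, h1, h2⟩ := Order.exists_between_finsets l r
      fun a ha b hb => hAB a (hl a ha) b (hr b hb)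
    exact ⟨z, hz z h1 h2⟩)
  refine ⟨a, fun b hb => ?_, fun b hb => ?_⟩
  · exact (hlo ⟨b, Or.inl hb⟩ a).1 (ha _ (Or.inl ⟨_, hb, rfl⟩))
  · exact (hhi ⟨b, Or.inr hb⟩ a).1 (ha _ (Or.inr ⟨_, hb, rfl⟩))

/-- A set of pairs on which the two order relations agree. -/
def IsPartialIso (s : Set (M × N)) : Prop :=
  ∀ p ∈ s, ∀ q ∈ s, p.1 < q.1 ↔ p.2 < q.2

theorem IsPartialIso.swap {s : Set (M × N)} (hs : IsPartialIso s) :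
    IsPartialIso (Prod.swap '' s) := by
  rintro _ ⟨p, hp, rfl⟩ _ ⟨q, hq, rfl⟩
  exact (hs p hp q hq).symm

theorem IsPartialIso.exists_extend_left (hN : IsEtaOne N) {s : Set (M × N)} (hs : IsPartialIso s)
    (hc : s.Countable) (m : M) :
    ∃ t, s ⊆ t ∧ t.Countable ∧ IsPartialIso t ∧ ∃ p ∈ t, p.1 = m := by
  by_cases hm : ∃ p ∈ s, p.1 = m
  · exact ⟨s, le_rfl, hc, hs, hm⟩
  push Not at hm
  obtain ⟨x, hx1, hx2⟩ := hN (Prod.snd '' {p ∈ s | p.1 < m}) (Prod.snd '' {p ∈ s | m < p.1})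
    ((hc.mono (Set.sep_subset _ _)).image _) ((hc.mono (Set.sep_subset _ _)).image _) (by
      rintro _ ⟨p, ⟨hp, hpm⟩, rfl⟩ _ ⟨q, ⟨hq, hqm⟩, rfl⟩
      exact (hs p hp q hq).1 (hpm.trans hqm))
  have key : ∀ p ∈ s, (p.1 < m ∧ p.2 < x) ∨ (m < p.1 ∧ x < p.2) := by
    intro p hp
    rcases lt_or_gt_of_ne (hm p hp) with h | h
    · exact Or.inl ⟨h, hx1 _ ⟨p, ⟨hp, h⟩, rfl⟩⟩
    · exact Or.inr ⟨h, hx2 _ ⟨p, ⟨hp, h⟩, rfl⟩⟩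
  refine ⟨insert (m, x) s, Set.subset_insert _ _, hc.insert _, ?_, (m, x), Set.mem_insert _ _, rfl⟩
  rintro p (rfl | hp) q (rfl | hq)
  · simp
  · rcases key q hq with h | h
    · exact ⟨fun h' => absurd h' h.1.not_gt, fun h' => absurd h' h.2.not_gt⟩
    · exact ⟨fun _ => h.2, fun _ => h.1⟩
  · rcases key p hp with h | h
    · exact ⟨fun _ => h.2, fun _ => h.1⟩
    · exact ⟨fun h' => absurd h' h.1.not_gt, fun h' => absurd h' h.2.not_gt⟩
  · exact hs p hp q hq

theorem IsPartialIso.exists_extend (hM : IsEtaOne M) (hN : IsEtaOne N) {s : Set (M × N)}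
    (hs : IsPartialIso s) (hc : s.Countable) (m : M) (n : N) :
    ∃ t, s ⊆ t ∧ t.Countable ∧ IsPartialIso t ∧ (∃ p ∈ t, p.1 = m) ∧ ∃ p ∈ t, p.2 = n := by
  obtain ⟨t, hst, htc, ht, p, hp, hpm⟩ := hs.exists_extend_left hN hc m
  obtain ⟨r, htr, hrc, hr, q, hq, hqn⟩ := ht.swap.exists_extend_left hM (htc.image _) n
  have hsub : t ⊆ Prod.swap '' r := fun x hx => ⟨x.swap, htr ⟨x, hx, rfl⟩, by simp⟩
  exact ⟨Prod.swap '' r, hst.trans hsub, hrc.image _, hr.swap, ⟨p, hsub hp, hpm⟩,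
    q.swap, ⟨q, hq, rfl⟩, hqn⟩

theorem IsPartialIso.iUnion_directed {ι : Type*} {g : ι → Set (M × N)}
    (hd : Directed (· ⊆ ·) g) (hg : ∀ i, IsPartialIso (g i)) : IsPartialIso (⋃ i, g i) := by
  intro p hp q hq
  obtain ⟨i, hi⟩ := Set.mem_iUnion.1 hp
  obtain ⟨j, hj⟩ := Set.mem_iUnion.1 hq
  obtain ⟨k, hik, hjk⟩ := hd i j
  exact hg k p (hik hi) q (hjk hj)

theorem IsPartialIso.exists_orderIso_of_total {s : Set (M × N)} (hs : IsPartialIso s)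
    (h1 : ∀ m, ∃ p ∈ s, p.1 = m) (h2 : ∀ n, ∃ p ∈ s, p.2 = n) :
    ∃ e : M ≃o N, ∀ p ∈ s, e p.1 = p.2 := by
  choose f hf hfm using h1
  have huniq : ∀ p ∈ s, ∀ q ∈ s, p.1 = q.1 → p.2 = q.2 := by
    intro p hp q hq h
    apply le_antisymm
    · exact not_lt.1 fun h' => (((hs q hq p hp).2 h').ne h.symm)
    · exact not_lt.1 fun h' => (((hs p hp q hq).2 h').ne h)
  have hmono : StrictMono fun m => (f m).2 := by
    intro a b hab
    exact (hs _ (hf a) _ (hf b)).1 (by rwa [hfm, hfm])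
  have hsurj : Function.Surjective fun m => (f m).2 := by
    intro n
    obtain ⟨p, hp, rfl⟩ := h2 n
    exact ⟨p.1, huniq _ (hf _) _ hp (hfm _)⟩
  exact ⟨hmono.orderIsoOfSurjective _ hsurj, fun p hp => huniq _ (hf _) _ hp (hfm _)⟩

/-- Back-and-forth of length `ω₁`: each stage has countably many predecessors, so the partial map
built so far is countable and the `η₁` property extends it by one more pair of requirements. -/
theorem IsPartialIso.exists_orderIso (hM : IsEtaOne M) (hN : IsEtaOne N) (hMc : #M ≤ ℵ₁)
    (hNc : #N ≤ ℵ₁) {s : Set (M × N)} (hs : IsPartialIso s) (hc : s.Countable) :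
    ∃ e : M ≃o N, ∀ p ∈ s, e p.1 = p.2 := by
  classical
  obtain ⟨m₀, -, -⟩ := hM ∅ ∅ (by simp) (by simp) (by simp)
  obtain ⟨n₀, -, -⟩ := hN ∅ ∅ (by simp) (by simp) (by simp)
  have : Nonempty M := ⟨m₀⟩
  have : Nonempty N := ⟨n₀⟩
  let ι : Type u := (ℵ₁ : Cardinal.{u}).ord.ToType
  have hι : #ι = ℵ₁ := by simp [ι]
  have hIio : ∀ a : ι, (Set.Iio a).Countable := by
    intro a
    rw [← Cardinal.le_aleph0_iff_set_countable, ← Cardinal.lt_aleph_one_iff]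
    have h := Cardinal.mk_Iio_lt a (by simp [ι])
    rwa [hι] at h
  have hι0 : Nonempty ι := Cardinal.mk_ne_zero_iff.1 (by rw [hι]; exact (Cardinal.aleph_pos 1).ne')
  obtain ⟨em⟩ : Nonempty (M ↪ ι) := by rwa [← hι] at hMc
  obtain ⟨en⟩ : Nonempty (N ↪ ι) := by rwa [← hι] at hNc
  let fm : ι → M := Function.invFun em
  let fn : ι → N := Function.invFun en
  have hfm : Function.Surjective fm := Function.invFun_surjective em.injective
  have hfn : Function.Surjective fn := Function.invFun_surjective en.injective
  let P : ι → Set (M × N) → Set (M × N) → Prop := fun a U t =>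
    U ⊆ t ∧ t.Countable ∧ IsPartialIso t ∧ (∃ p ∈ t, p.1 = fm a) ∧ ∃ p ∈ t, p.2 = fn a
  -- The value `∅` is never taken: `hP` shows by induction that an extension exists at every stage.
  let F : (a : ι) → ((b : ι) → b < a → Set (M × N)) → Set (M × N) := fun a ih =>
    if h : ∃ t, P a (s ∪ ⋃ b : Set.Iio a, ih b.1 b.2) t then h.choose else ∅
  let g : ι → Set (M × N) := (wellFounded_lt (α := ι)).fix F
  have hg : ∀ a, g a = F a fun b _ => g b := fun a => WellFounded.fix_eq _ F a
  have hP : ∀ a, P a (s ∪ ⋃ b : Set.Iio a, g b.1) (g a) := by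
    intro a
    induction a using WellFoundedLT.induction with
    | ind a ih =>
      have hex : ∃ t, P a (s ∪ ⋃ b : Set.Iio a, g b.1) t := by
        by_cases hne : Nonempty (Set.Iio a)
        · have hsub : s ∪ ⋃ b : Set.Iio a, g b.1 = ⋃ b : Set.Iio a, g b.1 := by
            refine Set.union_eq_self_of_subset_left ?_
            obtain ⟨b⟩ := hne
            exact (Set.subset_union_left.trans (ih b.1 b.2).1).trans
              (Set.subset_iUnion (fun b : Set.Iio a => g b.1) b)
          have : Countable (Set.Iio a) := (hIio a).to_subtype
          rw [hsub]
          refine IsPartialIso.exists_extend hM hN ?_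
            (Set.countable_iUnion fun b : Set.Iio a => (ih b.1 b.2).2.1) _ _
          refine IsPartialIso.iUnion_directed ?_ fun b : Set.Iio a => (ih b.1 b.2).2.2.1
          refine Monotone.directed_le (f := fun b : Set.Iio a => g b.1) fun b c hbc => ?_
          rcases hbc.eq_or_lt with h | h
          · rw [h]
          · exact ((Set.subset_iUnion (fun d : Set.Iio c.1 => g d.1) ⟨b.1, h⟩).trans
              Set.subset_union_right).trans (ih c.1 c.2).1
        · have hemp : ⋃ b : Set.Iio a, g b.1 = ∅ := by
            rw [not_nonempty_iff] at hne
            exact Set.iUnion_of_empty _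
          rw [hemp, Set.union_empty]
          exact hs.exists_extend hM hN hc _ _
      have h1 : g a = hex.choose := by
        rw [hg a]
        exact dif_pos hex
      rw [h1]
      exact hex.choose_spec
  have hmono : Monotone g := by
    intro b c hbc
    rcases hbc.eq_or_lt with h | h
    · rw [h]
    · exact ((Set.subset_iUnion (fun d : Set.Iio c => g d.1) ⟨b, h⟩).trans
        Set.subset_union_right).trans (hP c).1
  obtain ⟨e, he⟩ := (IsPartialIso.iUnion_directed (Monotone.directed_le hmono)
    fun a => (hP a).2.2.1).exists_orderIso_of_total (fun m => by
      obtain ⟨a, rfl⟩ := hfm m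
      obtain ⟨p, hp, h⟩ := (hP a).2.2.2.1
      exact ⟨p, Set.mem_iUnion.2 ⟨a, hp⟩, h⟩) (fun n => by
      obtain ⟨a, rfl⟩ := hfn n
      obtain ⟨p, hp, h⟩ := (hP a).2.2.2.2
      exact ⟨p, Set.mem_iUnion.2 ⟨a, hp⟩, h⟩)
  obtain ⟨a⟩ := hι0
  exact ⟨e, fun p hp => he p (Set.mem_iUnion.2 ⟨a, (hP a).1 (Or.inl hp)⟩)⟩

/-- The automorphism `h` fixes every point of `D`. -/
def Fixes (D : Set M) (h : Aut M) : Prop := ∀ e ∈ D, h e = e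

/-- The empty set and the closed initial segments. -/
def IsInitialSegment (D : Set M) : Prop := D = ∅ ∨ ∃ i, D = Set.Iic i

/-- For `D = Iic i`, an automorphism that extends the finite map and fixes `i` is replaced by the
identity on `Iic i`. The endpoint `i` is what makes this gluing possible. -/
theorem IsEtaOne.exists_aut_extending (hM : IsEtaOne M) (hMc : #M ≤ ℵ₁) {D : Set M}
    (hD : IsInitialSegment D) (S : Finset M) (p : M → M) (hp : StrictMonoOn p S)
    (hS : ∀ e ∈ S, e ∉ D) (hpS : ∀ e ∈ S, p e ∉ D) :
    ∃ h : Aut M, Fixes D h ∧ ∀ e ∈ S, h e = p e := by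
  have hgr : IsPartialIso ((fun e => (e, p e)) '' (S : Set M)) := by
    rintro _ ⟨a, ha, rfl⟩ _ ⟨b, hb, rfl⟩
    exact (hp.lt_iff_lt ha hb).symm
  have hgc : ((fun e => (e, p e)) '' (S : Set M)).Countable := S.countable_toSet.image _
  rcases hD with rfl | ⟨i, rfl⟩
  · obtain ⟨h, hh⟩ := hgr.exists_orderIso hM hM hMc hMc hgc
    exact ⟨h, fun e he => he.elim, fun e he => hh _ ⟨e, he, rfl⟩⟩
  simp only [Set.mem_Iic, not_le] at hS hpS
  have hgr' : IsPartialIso (insert (i, i) ((fun e => (e, p e)) '' (S : Set M))) := by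
    rintro _ (rfl | ⟨a, ha, rfl⟩) _ (rfl | ⟨b, hb, rfl⟩)
    · simp
    · exact ⟨fun _ => hpS b hb, fun _ => hS b hb⟩
    · exact ⟨fun h => absurd h (hS a ha).not_gt, fun h => absurd h (hpS a ha).not_gt⟩
    · exact (hp.lt_iff_lt ha hb).symm
  obtain ⟨h, hh⟩ := hgr'.exists_orderIso hM hM hMc hMc (hgc.insert _)
  have hi : h i = i := hh (i, i) (Set.mem_insert _ _)
  have hgt : ∀ e, i < e ↔ i < h e := fun e => by
    conv_rhs => rw [← hi]
    exact h.lt_iff_lt.symm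
  let q : M → M := fun e => if e ≤ i then e else h e
  have hq : StrictMono q := by
    intro a b hab
    simp only [q]
    split_ifs with h1 h2 h2
    · exact hab
    · exact h1.trans_lt ((hgt b).1 (not_le.1 h2))
    · exact absurd (hab.le.trans h2) h1
    · exact h.lt_iff_lt.2 hab
  have hqs : Function.Surjective q := by
    intro y
    by_cases hy : y ≤ i
    · exact ⟨y, if_pos hy⟩
    · refine ⟨h.symm y, ?_⟩
      have : ¬ h.symm y ≤ i := not_le.2 ((hgt _).2 (by simpa using hy))
      simp [q, this]
  refine ⟨hq.orderIsoOfSurjective q hqs, fun e he => ?_, fun e he => ?_⟩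
  · exact if_pos he
  · exact (if_neg (not_le.2 (hS e he))).trans (hh _ (Set.mem_insert_of_mem _ ⟨e, he, rfl⟩))

end EtaOne

/-! ### Ramsey's theorem and fixed points -/

/-- The finite Ramsey theorem for colourings of the `n`-element subsets of an unbounded order. -/
theorem exists_monochromatic_finset {M κ : Type*} [LinearOrder M] [Nonempty M] [NoMaxOrder M]
    [Finite κ] (n m : ℕ) (c : Finset M → κ) (i : M) :
    ∃ S : Finset M, S.card = m ∧ (∀ e ∈ S, i < e) ∧ ∃ k, ∀ F ⊆ S, F.card = n → c F = k := by
  classical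
  -- Ramsey by iterated limits along an ultrafilter that contains all final segments: `col j F` is
  -- the colour that `F` acquires after `j` successive generic large points are added. A homogeneous
  -- set is built upwards by points that are generic for all the finitely many constraints so far.
  let U : Ultrafilter M := Ultrafilter.of Filter.atTop
  have hU : (U : Filter M) ≤ Filter.atTop := Ultrafilter.of_le _
  have hlim : ∀ f : M → κ, ∃ k, ∀ᶠ a in (U : Filter M), f a = k := by
    intro f
    obtain ⟨k, hk⟩ := Ultrafilter.eq_pure_of_finite (U.map f)
    refine ⟨k, ?_⟩
    have : {k} ∈ U.map f := by rw [hk]; exact Set.mem_singleton k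
    exact this
  choose lim hlim using hlim
  let col : ℕ → Finset M → κ := fun j =>
    Nat.rec c (fun _ d F => lim fun a => d (insert a F)) j
  have hcol : ∀ j F, ∀ᶠ a in (U : Filter M), col j (insert a F) = col (j + 1) F :=
    fun j F => hlim fun a => col j (insert a F)
  suffices h : ∃ S : Finset M, S.card = m ∧ (∀ e ∈ S, i < e) ∧
      ∀ F ⊆ S, ∀ j, F.card + j = n → col j F = col n ∅ by
    obtain ⟨S, h1, h2, h3⟩ := h
    exact ⟨S, h1, h2, _, fun F hF hn => h3 F hF 0 hn⟩
  induction m with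
  | zero =>
    refine ⟨∅, rfl, by simp, fun F hF j hj => ?_⟩
    obtain rfl := Finset.subset_empty.1 hF
    simp only [Finset.card_empty, zero_add] at hj
    rw [hj]
  | succ m ih =>
    obtain ⟨S, h1, h2, h3⟩ := ih
    have e1 : ∀ᶠ a in (U : Filter M), i < a := hU (Filter.eventually_gt_atTop i)
    have e2 : ∀ᶠ a in (U : Filter M), ∀ e ∈ S, e < a :=
      (Filter.eventually_all_finset S).2 fun e _ => hU (Filter.eventually_gt_atTop e)
    have e3 : ∀ᶠ a in (U : Filter M), ∀ F ∈ S.powerset, ∀ j ∈ Finset.range n,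
        col j (insert a F) = col (j + 1) F :=
      (Filter.eventually_all_finset _).2 fun F _ => (Filter.eventually_all_finset _).2
        fun j _ => hcol j F
    obtain ⟨a, ha1, ha2, ha3⟩ := (e1.and (e2.and e3)).exists
    have haS : a ∉ S := fun h => (ha2 a h).false
    refine ⟨insert a S, by rw [Finset.card_insert_of_notMem haS, h1], ?_, fun F hF j hj => ?_⟩
    · intro e he
      rcases Finset.mem_insert.1 he with rfl | he
      exacts [ha1, h2 e he]
    · by_cases haF : a ∈ F
      · have hsub : F.erase a ⊆ S := by
          rw [← Finset.subset_insert_iff]; exact hF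
        have hcard := Finset.card_erase_add_one haF
        have hjn : j < n := by omega
        rw [← Finset.insert_erase haF, ha3 _ (Finset.mem_powerset.2 hsub) j
          (Finset.mem_range.2 hjn)]
        exact h3 _ hsub (j + 1) (by omega)
      · exact h3 F ((Finset.subset_insert_iff_of_notMem haF).1 hF) j hj

/-! ### Extreme amenability of the stabilizers of initial segments. -/

section Aut

variable {E : Type u} [LinearOrder E]

theorem exists_fixes_subset_of_mem_nhds_one {s : Set (Aut E)} (hs : s ∈ 𝓝 (1 : Aut E)) :
    ∃ F : Finset E, ∀ h : Aut E, Fixes (F : Set E) h → h ∈ s := by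
  classical
  let _ : TopologicalSpace E := ⊥
  have : DiscreteTopology E := ⟨rfl⟩
  rw [nhds_induced, Filter.mem_comap] at hs
  obtain ⟨t, ht, hts⟩ := hs
  rw [nhds_pi, Filter.mem_pi] at ht
  obtain ⟨I, hI, r, hr, hrt⟩ := ht
  refine ⟨hI.toFinset, fun h hh => hts (hrt fun e he => ?_)⟩
  have : h e = e := hh e (by simpa using he)
  change h e ∈ r e
  rw [this]
  exact mem_of_mem_nhds (hr e)

theorem eventually_apply_eq (h : Aut E) (e : E) : ∀ᶠ g in 𝓝 h, g e = h e := by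
  let _ : TopologicalSpace E := ⊥
  have : DiscreteTopology E := ⟨rfl⟩
  have hev : Continuous fun f : E ≃o E => f e := (continuous_apply e).comp continuous_induced_dom
  exact hev.continuousAt.eventually ((isOpen_discrete {h e}).mem_nhds rfl)

theorem Fixes.mul {D : Set E} {g h : Aut E} (hg : Fixes D g) (hh : Fixes D h) :
    Fixes D (g * h) := fun e he => by
  change g (h e) = e
  rw [hh e he, hg e he]

theorem Fixes.inv {D : Set E} {g : Aut E} (hg : Fixes D g) : Fixes D g⁻¹ := fun e he =>
  (OrderIso.symm_apply_eq g).2 (hg e he).symm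

theorem Fixes.apply_notMem {D : Set E} {g : Aut E} (hg : Fixes D g) {e : E} (he : e ∉ D) :
    g e ∉ D := fun h => he (by rwa [← g.injective (hg _ h)])

/-- A finite linear order has only one increasing enumeration. Hence colouring the images of `F`
amounts to colouring the restrictions of automorphisms to `F`. -/
theorem eqOn_of_image_eq {F : Finset E} {g h : Aut E} (hgh : F.image g = F.image h) :
    ∀ e ∈ F, g e = h e := by
  have key : ∀ k : Aut E, ∀ S : Finset E, ∀ hc : S.card = F.card, F.image k = S →
      ∀ j, k (F.orderEmbOfFin rfl j) = S.orderEmbOfFin hc j := by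
    intro k S hc hS
    have := Finset.orderEmbOfFin_unique hc (f := fun j => k (F.orderEmbOfFin rfl j))
      (fun j => by rw [← hS]; exact Finset.mem_image_of_mem _ (Finset.orderEmbOfFin_mem _ _ _))
      (k.strictMono.comp (F.orderEmbOfFin rfl).strictMono)
    exact fun j => congrFun this j
  intro e he
  have : e ∈ Set.range (F.orderEmbOfFin rfl) := by rwa [Finset.range_orderEmbOfFin]
  obtain ⟨j, rfl⟩ := this
  have hc : (F.image g).card = F.card := Finset.card_image_of_injective _ g.injective
  rw [key g _ hc rfl j, key h _ hc hgh.symm j]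

theorem exists_strictMonoOn_image_eq {M S : Finset E} (h : S.card = M.card) :
    ∃ p : E → E, StrictMonoOn p M ∧ ∀ e ∈ M, p e ∈ S := by
  classical
  let f : M ≃o S := (M.orderIsoOfFin rfl).symm.trans (S.orderIsoOfFin h)
  refine ⟨fun e => if he : e ∈ M then f ⟨e, he⟩ else e, fun a ha b hb hab => ?_, fun e he => ?_⟩
  · have ha' : a ∈ M := ha
    have hb' : b ∈ M := hb
    simp only [ha', hb', dif_pos]
    exact f.strictMono (by exact hab)
  · simp [he]

theorem IsInitialSegment.exists_forall_gt_notMem [Nonempty E] {D : Set E}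
    (hD : IsInitialSegment D) : ∃ i, ∀ e, i < e → e ∉ D := by
  rcases hD with rfl | ⟨i, rfl⟩
  · exact ⟨Classical.arbitrary E, by simp⟩
  · exact ⟨i, fun e he => not_le.2 he⟩

theorem IsEtaOne.noMaxOrder (hE : IsEtaOne E) : NoMaxOrder E :=
  ⟨fun a => by simpa using hE {a} ∅ (Set.countable_singleton a) Set.countable_empty (by simp)⟩

theorem IsEtaOne.nonempty (hE : IsEtaOne E) : Nonempty E := by
  obtain ⟨x, -⟩ := hE ∅ ∅ (by simp) (by simp) (by simp)
  exact ⟨x⟩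

/-- Pestov's argument. Up to a small entourage, `g⁻¹ • y₀` depends only on `g` restricted to a
finite set `F`, that is, on the image of `F`. This yields a finite colouring. If `g` moves `F` and
all `h⁻¹ F` into a homogeneous set, then `g⁻¹ • y₀` and `(g * h⁻¹)⁻¹ • y₀ = h • g⁻¹ • y₀` are close.
-/
theorem exists_forall_smul_mem_entourage {Y : Type*} [MulAction (Aut E) Y] [UniformSpace Y] [CompactSpace Y]
    [ContinuousSMul (Aut E) Y] (hE : IsEtaOne E) (hEc : #E ≤ ℵ₁) {D : Set E}
    (hD : IsInitialSegment D) {Z : Set Y} (hZn : Z.Nonempty)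
    (hZ : ∀ h, Fixes D h → ∀ y ∈ Z, h • y ∈ Z) {V : Set (Y × Y)} (hV : V ∈ uniformity Y)
    (hs : Finset (Aut E)) (hhs : ∀ h ∈ hs, Fixes D h) :
    ∃ y ∈ Z, ∀ h ∈ hs, (h • y, y) ∈ V := by
  classical
  have := hE.noMaxOrder
  have := hE.nonempty
  obtain ⟨W₁, hW₁, hW₁s, hW₁V⟩ := comp_symm_mem_uniformity_sets hV
  obtain ⟨W, hW, hWs, hWW⟩ := comp_symm_mem_uniformity_sets hW₁
  obtain ⟨t, -, htf, htc⟩ := (isCompact_univ (X := Y)).totallyBounded.exists_subset hW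
  have hcov : ∀ y : Y, ∃ q : t, (y, q.1) ∈ W := fun y => by
    obtain ⟨q, hq, h⟩ := Set.mem_iUnion₂.1 (htc (Set.mem_univ y))
    exact ⟨⟨q, hq⟩, h⟩
  choose cell hcell using hcov
  have : Finite t := htf
  have hnhds : ∀ᶠ u in 𝓝 (1 : Aut E), ∀ y ∈ (Set.univ : Set Y), (u • y, y) ∈ W := by
    refine isCompact_univ.eventually_forall_of_forall_eventually fun y _ => ?_
    have hcont : Continuous fun z : Aut E × Y => (z.1 • z.2, z.2) :=
      (continuous_fst.smul continuous_snd).prodMk continuous_snd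
    have htend := hcont.tendsto ((1 : Aut E), y)
    simp only [one_smul] at htend
    exact htend.eventually (nhds_le_uniformity y hW)
  obtain ⟨F₀, hF₀⟩ := exists_fixes_subset_of_mem_nhds_one hnhds
  -- All automorphisms in play fix `D`, so only the points outside `D` are to be coloured.
  let F := F₀.filter (· ∉ D)
  have hFD : ∀ e ∈ F, e ∉ D := fun e he => (Finset.mem_filter.1 he).2
  obtain ⟨y₀, hy₀⟩ := hZn
  let c : Finset E → t := fun F' =>
    if h : ∃ g : Aut E, Fixes D g ∧ F.image g = F' then cell (h.choose⁻¹ • y₀) else cell y₀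
  let M : Finset E := F ∪ hs.biUnion fun h => F.image (h⁻¹ : Aut E)
  have hMD : ∀ e ∈ M, e ∉ D := by
    intro e he
    rcases Finset.mem_union.1 he with he | he
    · exact hFD e he
    · obtain ⟨h, hh, he⟩ := Finset.mem_biUnion.1 he
      obtain ⟨e', he', rfl⟩ := Finset.mem_image.1 he
      exact (hhs h hh).inv.apply_notMem (hFD e' he')
  obtain ⟨i, hi⟩ := hD.exists_forall_gt_notMem
  obtain ⟨S, hSM, hSi, k, hk⟩ := exists_monochromatic_finset F.card M.card c i
  obtain ⟨p, hp, hpS⟩ := exists_strictMonoOn_image_eq hSM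
  obtain ⟨g, hgD, hg⟩ := hE.exists_aut_extending hEc hD M p hp hMD
    fun e he => hi _ (hSi _ (hpS e he))
  have hgS : ∀ e ∈ M, g e ∈ S := fun e he => by rw [hg e he]; exact hpS e he
  have key : ∀ a : Aut E, Fixes D a → (∀ e ∈ F, a e ∈ S) → (a⁻¹ • y₀, k.1) ∈ W₁ := by
    intro a ha haS
    have hex : ∃ g : Aut E, Fixes D g ∧ F.image g = F.image a := ⟨a, ha, rfl⟩
    have hc : c (F.image a) = cell (hex.choose⁻¹ • y₀) := dif_pos hex
    rw [hk _ (Finset.image_subset_iff.2 haS)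
      (Finset.card_image_of_injective _ a.injective)] at hc
    obtain ⟨hb, hba⟩ := hex.choose_spec
    set b := hex.choose
    have hfix : Fixes (F₀ : Set E) (a⁻¹ * b) := by
      intro e he
      by_cases heD : e ∈ D
      · exact ha.inv.mul hb e heD
      · change a.symm (b e) = e
        rw [eqOn_of_image_eq hba e (Finset.mem_filter.2 ⟨he, heD⟩), OrderIso.symm_apply_apply]
    have h1 := hF₀ _ hfix (b⁻¹ • y₀) (Set.mem_univ _)
    rw [mul_smul, smul_inv_smul] at h1
    refine hWW (SetRel.prodMk_mem_comp h1 ?_)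
    rw [hc]
    exact hcell _
  refine ⟨g⁻¹ • y₀, hZ _ hgD.inv _ hy₀, fun h hh => ?_⟩
  have h1 := key g hgD fun e he => hgS e (Finset.mem_union_left _ he)
  have h2 := key (g * h⁻¹) (hgD.mul (hhs h hh).inv) fun e he =>
    hgS _ (Finset.mem_union_right _ (Finset.mem_biUnion.2 ⟨h, hh, Finset.mem_image_of_mem _ he⟩))
  rw [mul_inv_rev, inv_inv, mul_smul] at h2
  exact hW₁V (SetRel.prodMk_mem_comp h2 (hW₁s.symm _ _ h1))

/-- Compactness turns points almost fixed by finitely many automorphisms into a point fixed by all.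
-/
theorem exists_fixed_point {Y : Type*} [TopologicalSpace Y] [CompactSpace Y] [T2Space Y]
    [MulAction (Aut E) Y] [ContinuousSMul (Aut E) Y] (hE : IsEtaOne E) (hEc : #E ≤ ℵ₁) {D : Set E}
    (hD : IsInitialSegment D) {Z : Set Y} (hZc : IsClosed Z) (hZn : Z.Nonempty)
    (hZ : ∀ h, Fixes D h → ∀ y ∈ Z, h • y ∈ Z) :
    ∃ y ∈ Z, ∀ h, Fixes D h → h • y = y := by
  classical
  let _ : UniformSpace Y := uniformSpaceOfCompactR1
  let ι := {h : Aut E // Fixes D h} × {V : Set (Y × Y) // V ∈ uniformity Y ∧ IsClosed V}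
  obtain ⟨y, hyZ, hy⟩ := hZc.isCompact.inter_iInter_nonempty
    (fun i : ι => {y | (i.1.1 • y, y) ∈ i.2.1})
    (fun i => i.2.2.2.preimage ((continuous_const_smul i.1.1).prodMk continuous_id)) (by
      intro s
      obtain ⟨y, hy, h⟩ := exists_forall_smul_mem_entourage hE hEc hD hZn hZ
        (V := ⋂ i ∈ s, i.2.1) ((Filter.biInter_finset_mem s).2 fun i _ => i.2.2.1)
        (s.image fun i => i.1.1) (by
          intro h hh
          obtain ⟨i, -, rfl⟩ := Finset.mem_image.1 hh
          exact i.1.2)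
      refine ⟨y, hy, Set.mem_iInter₂.2 fun i hi => ?_⟩
      exact Set.mem_iInter₂.1 (h _ (Finset.mem_image_of_mem _ hi)) i hi)
  refine ⟨y, hyZ, fun h hh => ?_⟩
  refine eq_of_uniformity_basis uniformity_hasBasis_closed fun {V} hV => ?_
  exact Set.mem_iInter.1 hy (⟨h, hh⟩, ⟨V, hV⟩)

end Aut

/-! ### Minimal flows of the semidirect product are minimal for `ℤ ^ E` -/

section Flow

variable {E : Type u} [LinearOrder E]

theorem permuteCoordinates_apply (h : Aut E) (k : E → Multiplicative ℤ) (e : E) :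
    permuteCoordinates E h k e = k (h⁻¹ e) := rfl

/-- Actions of `ℤ ^ E` and of `Aut E` on `Ω` that together form an action of the semidirect
product. -/
class SemidirectAction (E : Type u) [LinearOrder E] (Ω : Type*)
    [MulAction (E → Multiplicative ℤ) Ω] [MulAction (Aut E) Ω] : Prop where
  smul_smul_eq (h : Aut E) (k : E → Multiplicative ℤ) (x : Ω) :
    h • k • x = permuteCoordinates E h k • h • x

variable {Ω : Type*} [MulAction (E → Multiplicative ℤ) Ω] [MulAction (Aut E) Ω]

/-- The set `X` is invariant under `ℤ ^ E` and under the automorphisms that fix `D` pointwise. -/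
def IsInvariantSet (D : Set E) (X : Set Ω) : Prop :=
  (∀ k : E → Multiplicative ℤ, ∀ x ∈ X, k • x ∈ X) ∧ ∀ h : Aut E, Fixes D h → ∀ x ∈ X, h • x ∈ X

theorem IsInvariantSet.mono {D D' : Set E} (h : D ⊆ D') {X : Set Ω} (hX : IsInvariantSet D X) :
    IsInvariantSet D' X :=
  ⟨hX.1, fun g hg => hX.2 g fun e he => hg e (h he)⟩

/-- `C` is invariant under the elements of the semidirect product that are trivial on `F`. -/
def IsSupportedOn (F : Set E) (C : Set Ω) : Prop :=
  (∀ k : E → Multiplicative ℤ, (∀ e ∈ F, k e = 1) → ∀ x, k • x ∈ C ↔ x ∈ C) ∧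
    ∀ h : Aut E, Fixes F h → ∀ x, h • x ∈ C ↔ x ∈ C

theorem IsSupportedOn.smul_mem_congr {F : Set E} {C : Set Ω} (hC : IsSupportedOn F C)
    {k k' : E → Multiplicative ℤ} (h : ∀ e ∈ F, k e = k' e) (x : Ω) : k • x ∈ C ↔ k' • x ∈ C := by
  have := hC.1 (k * k'⁻¹) (fun e he => by simp [h e he]) (k' • x)
  rwa [← mul_smul, inv_mul_cancel_right] at this

/-- Moving `h` to the left replaces `k` by a permuted copy, which agrees with `k` on `F` because `h`
fixes `F`. -/
theorem IsSupportedOn.smul_smul_mem [SemidirectAction E Ω] {F : Set E} {C : Set Ω}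
    (hC : IsSupportedOn F C) {h : Aut E} (hh : Fixes F h) (k : E → Multiplicative ℤ) (x : Ω) :
    k • h • x ∈ C ↔ k • x ∈ C := by
  have h1 : k • h • x = h • permuteCoordinates E h⁻¹ k • x := by
    rw [SemidirectAction.smul_smul_eq, ← MulAut.mul_apply, ← map_mul, mul_inv_cancel, map_one,
      MulAut.one_apply]
  rw [h1, hC.2 h hh]
  refine hC.smul_mem_congr (fun e he => ?_) x
  rw [permuteCoordinates_apply, inv_inv, hh e he]

variable [TopologicalSpace Ω]

/-- A minimal nonempty closed set with the invariance `IsInvariantSet D`. -/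
structure IsMinimalInvariantSet (D : Set E) (X : Set Ω) : Prop where
  isClosed : IsClosed X
  nonempty : X.Nonempty
  invariant : IsInvariantSet D X
  eq_of_subset : ∀ Z ⊆ X, IsClosed Z → Z.Nonempty → IsInvariantSet D Z → Z = X

theorem exists_isMinimalInvariantSet [CompactSpace Ω] (D : Set E) {X : Set Ω} (hX : IsClosed X)
    (hXn : X.Nonempty) (hXi : IsInvariantSet D X) : ∃ Y ⊆ X, IsMinimalInvariantSet D Y := by
  obtain ⟨Y, hYX, hY⟩ := zorn_superset_nonempty
    {Z : Set Ω | Z ⊆ X ∧ IsClosed Z ∧ Z.Nonempty ∧ IsInvariantSet D Z} (by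
      intro c hc hchain hcn
      refine ⟨⋂₀ c, ⟨?_, isClosed_sInter fun Z hZ => (hc hZ).2.1, ?_, ?_, ?_⟩,
        fun s hs => Set.sInter_subset_of_mem hs⟩
      · obtain ⟨Z, hZ⟩ := hcn
        exact (Set.sInter_subset_of_mem hZ).trans (hc hZ).1
      · have : Nonempty c := hcn.to_subtype
        exact IsCompact.nonempty_sInter_of_directed_nonempty_isCompact_isClosed
          (fun a ha b hb => by
            rcases hchain.total ha hb with h | h
            · exact ⟨a, ha, le_rfl, h⟩
            · exact ⟨b, hb, h, le_rfl⟩) (fun Z hZ => (hc hZ).2.2.1)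
          (fun Z hZ => (hc hZ).2.1.isCompact) fun Z hZ => (hc hZ).2.1
      · exact fun k x hx Z hZ => (hc hZ).2.2.2.1 k x (hx Z hZ)
      · exact fun h hh x hx Z hZ => (hc hZ).2.2.2.2 h hh x (hx Z hZ)) X ⟨le_rfl, hX, hXn, hXi⟩
  have hYp := hY.prop
  refine ⟨Y, hYX, hYp.2.1, hYp.2.2.1, hYp.2.2.2, fun Z hZY hZc hZn hZi => ?_⟩
  exact le_antisymm hZY (hY.le_of_le ⟨hZY.trans hYX, hZc, hZn, hZi⟩ hZY)

theorem IsInitialSegment.subset_Iic {D : Set E} (hD : IsInitialSegment D) {f : E} (hf : f ∉ D) :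
    D ⊆ Set.Iic f := by
  rcases hD with rfl | ⟨i, rfl⟩
  · exact Set.empty_subset _
  · exact Set.Iic_subset_Iic.2 (not_le.1 hf).le

theorem IsEtaOne.exists_lt_finset (hE : IsEtaOne E) {D : Set E} (hD : IsInitialSegment D)
    (S : Finset E) (hS : ∀ e ∈ S, e ∉ D) : ∃ j, j ∉ D ∧ ∀ e ∈ S, j < e := by
  rcases hD with rfl | ⟨i, rfl⟩
  · obtain ⟨j, -, hj⟩ := hE ∅ S Set.countable_empty S.countable_toSet (by simp)
    exact ⟨j, id, hj⟩
  · obtain ⟨j, hj1, hj2⟩ := hE {i} S (Set.countable_singleton i) S.countable_toSet (by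
      rintro _ rfl b hb
      exact not_le.1 (hS b hb))
    exact ⟨j, not_le.2 (hj1 i rfl), hj2⟩

theorem IsEtaOne.exists_fixes_apply_eq (hE : IsEtaOne E) (hEc : #E ≤ ℵ₁) {D : Set E}
    (hD : IsInitialSegment D) {a b : E} (ha : a ∉ D) (hb : b ∉ D) :
    ∃ g : Aut E, Fixes D g ∧ g a = b := by
  obtain ⟨g, hg, h⟩ := hE.exists_aut_extending hEc hD {a} (fun _ => b) (by simp [StrictMonoOn])
    (by simpa using ha) (by simpa using hb)
  exact ⟨g, hg, h a (by simp)⟩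

variable [CompactSpace Ω] [T2Space Ω] [ContinuousSMul (E → Multiplicative ℤ) Ω]
  [ContinuousSMul (Aut E) Ω]

-- Since `x` is fixed by the stabilizer of `D`, this stabilizer permutes the `ℤ ^ E`-orbit of `x`.
-- The orbit closure is therefore invariant, and minimality makes it all of `X`.
omit [CompactSpace Ω] [T2Space Ω] in
theorem IsMinimalInvariantSet.mem_closure_of_fixed [SemidirectAction E Ω] {D : Set E} {X : Set Ω}
    (hX : IsMinimalInvariantSet D X) {x y : Ω} (hx : x ∈ X) (hfix : ∀ h, Fixes D h → h • x = x)
    (hy : y ∈ X) : y ∈ closure (Set.range fun k : E → Multiplicative ℤ => k • x) := by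
  rw [hX.eq_of_subset (closure (Set.range fun k : E → Multiplicative ℤ => k • x)) ?_
    isClosed_closure ⟨x, subset_closure ⟨1, one_smul _ _⟩⟩ ⟨fun k z hz => ?_, fun h hh z hz => ?_⟩]
  · exact hy
  · refine closure_minimal ?_ hX.isClosed
    rintro _ ⟨k, rfl⟩
    exact hX.invariant.1 k x hx
  · refine map_mem_closure (continuous_const_smul k) hz ?_
    rintro _ ⟨k', rfl⟩
    exact ⟨k * k', mul_smul k k' x⟩
  · refine map_mem_closure (continuous_const_smul h) hz ?_
    rintro _ ⟨k', rfl⟩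
    refine ⟨permuteCoordinates E h k', ?_⟩
    simp only
    rw [SemidirectAction.smul_smul_eq, hfix h hh]

omit [MulAction (E → Multiplicative ℤ) Ω] [ContinuousSMul (E → Multiplicative ℤ) Ω] in
/-- A point fixed by the stabilizer of a closed initial segment `(-∞, m]` can be moved, in the
limit, to a point that is fixed by the stabilizer of a smaller initial segment. -/
theorem exists_fixed_limit (hE : IsEtaOne E) (hEc : #E ≤ ℵ₁) {D : Set E}
    (hD : IsInitialSegment D) {X : Set Ω} (hXc : IsClosed X)
    (hXi : ∀ h : Aut E, Fixes D h → ∀ x ∈ X, h • x ∈ X) {m : E} (hm : m ∉ D) {x : Ω} (hx : x ∈ X)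
    (hfix : ∀ v, Fixes (Set.Iic m) v → v • x = x) :
    ∃ z ∈ X, (∀ h, Fixes D h → h • z = z) ∧
      z ∈ closure {w | ∃ g : Aut E, Fixes D g ∧ g m ≤ m ∧ w = g • x} := by
  classical
  -- A translate `g • x` with `g m ≤ j` is fixed by the stabilizer of `Iic j`. As `j` descends
  -- towards `D`, these stabilizers approximate the stabilizer of `D`, so a point common to all
  -- closures is fixed by the latter.
  let T : {j // j ∉ D} → Set Ω := fun j =>
    closure {w | ∃ g : Aut E, Fixes D g ∧ g m ≤ j.1 ∧ w = g • x}
  have hTmono : Monotone T := fun i j hij => closure_mono (by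
    rintro _ ⟨g, hg, hgm, rfl⟩
    exact ⟨g, hg, hgm.trans hij, rfl⟩)
  have : Nonempty {j // j ∉ D} := ⟨⟨m, hm⟩⟩
  obtain ⟨z, hz⟩ := IsCompact.nonempty_iInter_of_directed_nonempty_isCompact_isClosed T
    (fun i j => ⟨min i j, hTmono (min_le_left _ _), hTmono (min_le_right _ _)⟩)
    (fun j => by
      obtain ⟨g, hg, hgm⟩ := hE.exists_fixes_apply_eq hEc hD hm j.2
      exact ⟨g • x, subset_closure ⟨g, hg, hgm.le, rfl⟩⟩)
    (fun j => isClosed_closure.isCompact) fun j => isClosed_closure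
  rw [Set.mem_iInter] at hz
  refine ⟨z, closure_minimal ?_ hXc (hz ⟨m, hm⟩), fun h hh => ?_, hz ⟨m, hm⟩⟩
  · rintro _ ⟨g, hg, -, rfl⟩
    exact hXi g hg x hx
  by_contra hne
  obtain ⟨P', P, hP', hP, hzP', hzP, hdisj⟩ := t2_separation hne
  have hcont : Continuous fun q : Aut E × Ω => h • q.1 • q.2 :=
    (continuous_fst.smul continuous_snd).const_smul h
  have h1 : ∀ᶠ q : Aut E × Ω in 𝓝 1 ×ˢ 𝓝 z, h • q.1 • q.2 ∈ P' := by
    rw [← nhds_prod_eq]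
    refine hcont.continuousAt.eventually (hP'.mem_nhds ?_)
    simpa using hzP'
  obtain ⟨A, hA, O, hO, hAO⟩ := Filter.eventually_prod_iff.1 h1
  obtain ⟨F₀, hF₀⟩ := exists_fixes_subset_of_mem_nhds_one hA
  let F := F₀.filter (· ∉ D)
  have hF : ∀ e ∈ F, e ∉ D := fun e he => (Finset.mem_filter.1 he).2
  obtain ⟨j, hjD, hj⟩ := hE.exists_lt_finset hD (F ∪ F.image h) (by
    intro e he
    rcases Finset.mem_union.1 he with he | he
    · exact hF e he
    · obtain ⟨e', he', rfl⟩ := Finset.mem_image.1 he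
      exact hh.apply_notMem (hF e' he'))
  -- `h'` agrees with `h` on `F` but fixes `Iic j`. Thus `h'` fixes `g • x`, while `h⁻¹ * h'` lies
  -- in the given neighbourhood of `1`; near `z` the action of `h` cannot be told from that of `h'`.
  obtain ⟨h', hh', hh'F⟩ := hE.exists_aut_extending hEc (D := Set.Iic j) (Or.inr ⟨j, rfl⟩) F h
    (h.strictMono.strictMonoOn _)
    (fun e he => not_le.2 (hj e (Finset.mem_union_left _ he)))
    (fun e he => not_le.2 (hj _ (Finset.mem_union_right _ (Finset.mem_image_of_mem _ he))))
  obtain ⟨_, ⟨hwO, hwP⟩, g, hg, hgm, rfl⟩ := mem_closure_iff_nhds.1 (hz ⟨j, hjD⟩) _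
    (Filter.inter_mem hO (hP.mem_nhds hzP))
  have hgx : h' • g • x = g • x := by
    have : Fixes (Set.Iic m) (g⁻¹ * h' * g) := by
      intro e he
      change g.symm (h' (g e)) = e
      rw [hh' (g e) ((g.monotone he).trans hgm), OrderIso.symm_apply_apply]
    conv_rhs => rw [← hfix _ this, ← mul_smul, ← mul_assoc, mul_inv_cancel_left, mul_smul]
  have hu : Fixes (F₀ : Set E) (h⁻¹ * h') := by
    intro e he
    by_cases heD : e ∈ D
    · have h2 : h' e = e := hh' e (hD.subset_Iic hjD heD)
      change h⁻¹ (h' e) = e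
      rw [h2, hh.inv e heD]
    · change h.symm (h' e) = e
      rw [hh'F e (Finset.mem_filter.2 ⟨he, heD⟩), OrderIso.symm_apply_apply]
  have h3 := hAO (hF₀ _ hu) hwO
  rw [← mul_smul, mul_inv_cancel_left, hgx] at h3
  exact Set.disjoint_left.1 hdisj h3 hwP

/-- Induction on `M`, adding a new least point `m`. Either `h` sends the part of `F` outside `D`
into the old `M`, where the previous point `y'` is approximated, or `h f = m`, where the new point
looks like a point of `X₁`, which avoids `C`. The witness `y` serves both cases at once. -/
theorem IsMinimalInvariantSet.exists_avoid [SemidirectAction E Ω] (hE : IsEtaOne E)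
    (hEc : #E ≤ ℵ₁) {D : Set E} (hD : IsInitialSegment D) {X X₁ : Set Ω}
    (hX : IsMinimalInvariantSet D X) {f : E} (hfD : f ∉ D)
    (hX₁ : IsMinimalInvariantSet (Set.Iic f) X₁) (hX₁X : X₁ ⊆ X) {C : Set Ω} (hC : IsClopen C)
    {F : Set E} (hCF : IsSupportedOn F C) (hf : f ∈ F) (hfmin : ∀ e ∈ F, e ∉ D → f ≤ e)
    (hX₁C : ∀ x ∈ X₁, x ∉ C) (hFfin : F.Finite) (M : Finset E) (hM : ∀ e ∈ M, e ∉ D) :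
    ∃ y ∈ X, ∀ h : Aut E, Fixes D h → (∀ e ∈ F, e ∉ D → h e ∈ M) →
      ∀ k : E → Multiplicative ℤ, k • h⁻¹ • y ∉ C := by
  classical
  induction M using Finset.induction_on_min with
  | empty =>
    obtain ⟨y, hy⟩ := hX.nonempty
    exact ⟨y, hy, fun h _ hh => by simpa using hh f hf hfD⟩
  | insert m M hmM ih =>
    obtain ⟨y', hy', hav⟩ := ih fun e he => hM e (Finset.mem_insert_of_mem he)
    have hmD := hM m (Finset.mem_insert_self _ _)
    obtain ⟨g₀, hg₀, hg₀f⟩ := hE.exists_fixes_apply_eq hEc hD hfD hmD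
    obtain ⟨x₁, hx₁, hx₁fix⟩ := exists_fixed_point hE hEc (D := Set.Iic f) (Or.inr ⟨f, rfl⟩)
      hX₁.isClosed hX₁.nonempty hX₁.invariant.2
    have hx₁X := hX₁X hx₁
    have hfix : ∀ v, Fixes (Set.Iic m) v → v • g₀ • x₁ = g₀ • x₁ := by
      intro v hv
      have : Fixes (Set.Iic f) (g₀⁻¹ * v * g₀) := by
        intro e he
        change g₀.symm (v (g₀ e)) = e
        rw [hv (g₀ e) ((g₀.monotone he).trans hg₀f.le), OrderIso.symm_apply_apply]
      conv_rhs => rw [← hx₁fix _ this, ← mul_smul, ← mul_assoc, mul_inv_cancel_left, mul_smul]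
    obtain ⟨x₂, hx₂, hx₂fix, hx₂cl⟩ := exists_fixed_limit hE hEc hD hX.isClosed hX.invariant.2 hmD
      (hX.invariant.2 g₀ hg₀ x₁ hx₁X) hfix
    let ι := {q : Aut E × (E → Multiplicative ℤ) //
      Fixes D q.1 ∧ ∀ e ∈ F, e ∉ D → q.1 e ∈ insert m M}
    obtain ⟨y, hyX, hy⟩ := hX.isClosed.isCompact.inter_iInter_nonempty
      (fun i : ι => {y | i.1.2 • i.1.1⁻¹ • y ∉ C})
      (fun i => hC.compl.isClosed.preimage
        ((continuous_const_smul i.1.2).comp (continuous_const_smul (i.1.1)⁻¹))) (by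
      intro s
      let T : Set Ω := {y | ∀ i ∈ s, (∀ e ∈ F, e ∉ D → i.1.1 e ∈ M) → i.1.2 • i.1.1⁻¹ • y ∉ C}
      have hT : IsOpen T := by
        have : T = ⋂ i ∈ s, {y | (∀ e ∈ F, e ∉ D → i.1.1 e ∈ M) → i.1.2 • i.1.1⁻¹ • y ∉ C} := by
          ext; simp [T]
        rw [this]
        refine isOpen_biInter_finset fun i _ => ?_
        by_cases hi : ∀ e ∈ F, e ∉ D → i.1.1 e ∈ M
        · have heq : {y | (∀ e ∈ F, e ∉ D → i.1.1 e ∈ M) → i.1.2 • i.1.1⁻¹ • y ∉ C} =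
              {y | i.1.2 • i.1.1⁻¹ • y ∉ C} := by
            ext
            exact ⟨fun h => h hi, fun h _ => h⟩
          rw [heq]
          exact hC.compl.isOpen.preimage
            ((continuous_const_smul i.1.2).comp (continuous_const_smul (i.1.1)⁻¹))
        · simp [hi]
      -- The point `y'` is a limit of `ℤ ^ E`-translates of `x₂`, and `x₂` a limit of points `g • g₀
      -- • x₁`. Finitely many avoidance conditions, being open, pass from `y'` to some `k₁ • g • g₀
      -- • x₁`.
      obtain ⟨_, hk₁T, k₁, rfl⟩ := mem_closure_iff.1 (hX.mem_closure_of_fixed hx₂ hx₂fix hy') T hT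
        fun i _ hi => hav _ i.2.1 hi _
      obtain ⟨_, hgT, g, hg, hgm, rfl⟩ := mem_closure_iff.1 hx₂cl _
        (hT.preimage (continuous_const_smul k₁)) hk₁T
      -- The correction `v⁻¹ * g⁻¹` is the identity on `M`, so the conditions for the old `M`
      -- survive. It also cancels `g`: as `v` fixes `g₀ • x₁`, the corrected point is a `ℤ ^
      -- E`-translate of `g₀ • x₁`.
      obtain ⟨v, hv, hvM⟩ := hE.exists_aut_extending hEc (D := Set.Iic m) (Or.inr ⟨m, rfl⟩) M (g⁻¹ : Aut E)
        ((g⁻¹).strictMono.strictMonoOn _) (fun e he => not_le.2 (hmM e he)) (fun e he => by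
          refine not_le.2 (g.lt_iff_lt.1 ?_)
          change g m < g (g.symm e)
          rw [OrderIso.apply_symm_apply]
          exact hgm.trans_lt (hmM e he))
      have hvD : Fixes D v := fun e he => hv e (hD.subset_Iic hmD he)
      have hyeq : (v⁻¹ * g⁻¹) • k₁ • g • g₀ • x₁ =
          permuteCoordinates E (v⁻¹ * g⁻¹) k₁ • g₀ • x₁ := by
        rw [SemidirectAction.smul_smul_eq, ← mul_smul (v⁻¹ * g⁻¹) g, inv_mul_cancel_right,
          hfix _ hv.inv]
      refine ⟨(v⁻¹ * g⁻¹) • k₁ • g • g₀ • x₁, ?_, Set.mem_iInter₂.2 fun i hi => ?_⟩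
      · rw [hyeq]
        exact hX.invariant.1 _ _ (hX.invariant.2 _ hg₀ _ hx₁X)
      obtain ⟨⟨h, k⟩, hhD, hhM⟩ := i
      change k • h⁻¹ • _ ∉ C
      by_cases hcase : ∀ e ∈ F, e ∉ D → h e ∈ M
      · have hw : Fixes F (h⁻¹ * (v⁻¹ * g⁻¹) * h) := by
          intro e he
          by_cases heD : e ∈ D
          · exact ((hhD.inv.mul (hvD.inv.mul hg.inv)).mul hhD) e heD
          · change h.symm (v.symm (g⁻¹ (h e))) = e
            rw [← hvM _ (hcase e he heD), OrderIso.symm_apply_apply, OrderIso.symm_apply_apply]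
        have := hCF.smul_smul_mem hw k (h⁻¹ • k₁ • g • g₀ • x₁)
        rw [← mul_smul _ h⁻¹, mul_inv_cancel_right, mul_smul] at this
        rw [this]
        exact hgT ⟨(h, k), hhD, hhM⟩ hi hcase
      · push Not at hcase
        obtain ⟨e, heF, heD, heM⟩ := hcase
        have hem : h e = m := (Finset.mem_insert.1 (hhM e heF heD)).resolve_right heM
        have hhf : h f = m := by
          rcases Finset.mem_insert.1 (hhM f hf hfD) with h1 | h1
          · exact h1
          · exact absurd (hmM _ h1) (not_lt.2 (hem ▸ h.monotone (hfmin e heF heD)))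
        set z := h⁻¹ * g₀ with hz
        have hzD : Fixes D z := hhD.inv.mul hg₀
        have hzf : z f = f := by
          change h.symm (g₀ f) = f
          rw [hg₀f, ← hhf, OrderIso.symm_apply_apply]
        have hzf' : z⁻¹ f = f := (OrderIso.symm_apply_eq z).2 hzf.symm
        -- `z = h⁻¹ * g₀` fixes `D` and `f`, but perhaps not the rest of `F`. Since `x₁` is fixed by
        -- the stabilizer of `Iic f`, `z` may be replaced by `z * q`, which fixes all of `F`.
        obtain ⟨q, hq, hqF⟩ := hE.exists_aut_extending hEc (D := Set.Iic f) (Or.inr ⟨f, rfl⟩)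
          (hFfin.toFinset.filter (f < ·)) (z⁻¹ : Aut E) ((z⁻¹).strictMono.strictMonoOn _)
          (fun e he => not_le.2 (Finset.mem_filter.1 he).2)
          (fun e he => not_le.2 (by
            have := (z⁻¹).strictMono (Finset.mem_filter.1 he).2
            rwa [hzf'] at this))
        have hw : Fixes F (z * q) := by
          intro e he
          change z (q e) = e
          by_cases heD : e ∈ D
          · rw [hq e (hD.subset_Iic hfD heD), hzD e heD]
          · rcases (hfmin e he heD).eq_or_lt with rfl | hlt
            · rw [hq f le_rfl, hzf]
            · rw [hqF e (Finset.mem_filter.2 ⟨by simpa using he, hlt⟩)]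
              exact z.apply_symm_apply e
        rw [hyeq, SemidirectAction.smul_smul_eq, ← mul_smul k, ← mul_smul h⁻¹, ← hz]
        have hzx : z • x₁ = (z * q) • x₁ := by rw [mul_smul z q, hx₁fix q hq]
        rw [hzx, hCF.smul_smul_mem hw]
        exact hX₁C _ (hX₁.invariant.1 _ _ hx₁))
    exact ⟨y, hyX, fun h hh hhM k => Set.mem_iInter.1 hy ⟨(h, k), hh, hhM⟩⟩

/-- If `X₁` missed `C`, then `exists_avoid` and compactness would give a point of `X` none of whose
translates lies in `C`. Such points form a closed invariant set, hence all of `X`, although `X`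
meets `C`. -/
theorem IsMinimalInvariantSet.inter_nonempty [SemidirectAction E Ω] (hE : IsEtaOne E)
    (hEc : #E ≤ ℵ₁) {D : Set E} (hD : IsInitialSegment D) {X X₁ : Set Ω}
    (hX : IsMinimalInvariantSet D X) {f : E} (hfD : f ∉ D)
    (hX₁ : IsMinimalInvariantSet (Set.Iic f) X₁) (hX₁X : X₁ ⊆ X) {C : Set Ω} (hC : IsClopen C)
    {F : Set E} (hCF : IsSupportedOn F C) (hf : f ∈ F) (hfmin : ∀ e ∈ F, e ∉ D → f ≤ e)
    (hFfin : F.Finite) (hXC : (X ∩ C).Nonempty) : (X₁ ∩ C).Nonempty := by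
  classical
  by_contra hemp
  rw [Set.not_nonempty_iff_eq_empty] at hemp
  have hX₁C : ∀ x ∈ X₁, x ∉ C := fun x hx hxC => by
    have : x ∈ X₁ ∩ C := ⟨hx, hxC⟩
    rwa [hemp] at this
  let ι := {h : Aut E // Fixes D h} × (E → Multiplicative ℤ)
  have hcl : ∀ i : ι, IsClosed {y : Ω | i.2 • i.1.1⁻¹ • y ∉ C} := fun i =>
    hC.compl.isClosed.preimage
      ((continuous_const_smul i.2).comp (continuous_const_smul (i.1.1)⁻¹))
  have hne := hX.isClosed.isCompact.inter_iInter_nonempty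
    (fun i : ι => {y | i.2 • i.1.1⁻¹ • y ∉ C}) hcl (by
    intro s
    obtain ⟨y, hy, hav⟩ := hX.exists_avoid hE hEc hD hfD hX₁ hX₁X hC hCF hf hfmin hX₁C hFfin
      (s.biUnion fun i => (hFfin.toFinset.filter (· ∉ D)).image i.1.1) (by
        intro e he
        obtain ⟨i, -, he⟩ := Finset.mem_biUnion.1 he
        obtain ⟨e', he', rfl⟩ := Finset.mem_image.1 he
        exact i.1.2.apply_notMem (Finset.mem_filter.1 he').2)
    refine ⟨y, hy, Set.mem_iInter₂.2 fun i hi => hav i.1.1 i.1.2 (fun e he heD => ?_) i.2⟩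
    exact Finset.mem_biUnion.2 ⟨i, hi, Finset.mem_image_of_mem _
      (Finset.mem_filter.2 ⟨by simpa using he, heD⟩)⟩)
  have heq := hX.eq_of_subset _ Set.inter_subset_left
    (hX.isClosed.inter (isClosed_iInter hcl)) hne ⟨fun k x hx => ?_, fun h hh x hx => ?_⟩
  · obtain ⟨x, hx, hxC⟩ := hXC
    rw [← heq] at hx
    have := Set.mem_iInter.1 hx.2 (⟨1, fun e _ => rfl⟩, 1)
    simp only [inv_one, one_smul, Set.mem_ofPred_eq] at this
    exact this hxC
  · refine ⟨hX.invariant.1 k x hx.1, Set.mem_iInter.2 fun i => ?_⟩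
    have := Set.mem_iInter.1 hx.2 (i.1, i.2 * permuteCoordinates E i.1.1⁻¹ k)
    simp only [Set.mem_ofPred_eq] at this ⊢
    rwa [SemidirectAction.smul_smul_eq, ← mul_smul]
  · refine ⟨hX.invariant.2 h hh x hx.1, Set.mem_iInter.2 fun i => ?_⟩
    have := Set.mem_iInter.1 hx.2 (⟨h⁻¹ * i.1.1, hh.inv.mul i.1.2⟩, i.2)
    simp only [Set.mem_ofPred_eq] at this ⊢
    rwa [mul_inv_rev, inv_inv, mul_smul] at this

/-- Induction on the number of points of `F` outside `D`. When there are none, the stabilizer of `D`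
fixes `F`, so the points of `X` without a translate in `C` form a closed invariant proper subset,
which is empty. -/
theorem IsMinimalInvariantSet.exists_smul_mem [SemidirectAction E Ω] (hE : IsEtaOne E)
    (hEc : #E ≤ ℵ₁) (n : ℕ) {D : Set E} (hD : IsInitialSegment D) {X : Set Ω}
    (hX : IsMinimalInvariantSet D X) {C : Set Ω} (hC : IsClopen C) (F : Finset E)
    (hCF : IsSupportedOn (F : Set E) C) (hn : {e ∈ (F : Set E) | e ∉ D}.ncard = n)
    (hXC : (X ∩ C).Nonempty) {y : Ω} (hy : y ∈ X) : ∃ k : E → Multiplicative ℤ, k • y ∈ C := by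
  classical
  induction n generalizing D X C y with
  | zero =>
    have hFD : ∀ e ∈ F, e ∈ D := by
      intro e he
      by_contra heD
      rw [Set.ncard_eq_zero (F.finite_toSet.subset (Set.sep_subset _ _))] at hn
      have : e ∈ {e ∈ (F : Set E) | e ∉ D} := ⟨he, heD⟩
      rwa [hn] at this
    by_contra! hno
    have hcl : IsClosed (X ∩ ⋂ k : E → Multiplicative ℤ, {y | k • y ∉ C}) :=
      hX.isClosed.inter (isClosed_iInter fun k =>
        hC.compl.isClosed.preimage (continuous_const_smul k))
    have heq := hX.eq_of_subset _ Set.inter_subset_left hcl ⟨y, hy, Set.mem_iInter.2 hno⟩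
      ⟨fun k x hx => ⟨hX.invariant.1 k x hx.1, Set.mem_iInter.2 fun k' => ?_⟩,
        fun h hh x hx => ⟨hX.invariant.2 h hh x hx.1, Set.mem_iInter.2 fun k' => ?_⟩⟩
    · obtain ⟨x, hx, hxC⟩ := hXC
      rw [← heq] at hx
      have := Set.mem_iInter.1 hx.2 1
      simp only [one_smul, Set.mem_ofPred_eq] at this
      exact this hxC
    · have := Set.mem_iInter.1 hx.2 (k' * k)
      rwa [Set.mem_ofPred_eq, mul_smul] at this
    · rw [Set.mem_ofPred_eq, hCF.smul_smul_mem fun e he => hh e (hFD e he)]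
      exact Set.mem_iInter.1 hx.2 k'
  | succ n ih =>
    let F' := F.filter (· ∉ D)
    have hF' : {e ∈ (F : Set E) | e ∉ D} = F' := by ext; simp [F']
    rw [hF', Set.ncard_coe_finset] at hn
    have hF'n : F'.Nonempty := Finset.card_pos.1 (by omega)
    set f := F'.min' hF'n with hfdef
    have hfF' : f ∈ F' := Finset.min'_mem _ _
    obtain ⟨hfF, hfD⟩ := Finset.mem_filter.1 hfF'
    have hfmin : ∀ e ∈ (F : Set E), e ∉ D → f ≤ e := fun e he heD =>
      Finset.min'_le _ _ (Finset.mem_filter.2 ⟨he, heD⟩)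
    have hDsub := hD.subset_Iic hfD
    obtain ⟨X₁, hX₁X, hX₁⟩ := exists_isMinimalInvariantSet (Set.Iic f) hX.isClosed hX.nonempty
      (hX.invariant.mono hDsub)
    have hcard : {e ∈ (F : Set E) | e ∉ Set.Iic f}.ncard = n := by
      have : {e ∈ (F : Set E) | e ∉ Set.Iic f} = F'.erase f := by
        ext e
        simp only [Set.mem_Iic, not_le, Set.mem_ofPred_eq, Finset.coe_erase, Set.mem_sdiff,
          Finset.mem_coe, Set.mem_singleton_iff]
        refine ⟨fun ⟨h1, h2⟩ => ⟨Finset.mem_filter.2 ⟨h1, fun h => ?_⟩, h2.ne'⟩, fun ⟨h1, h2⟩ =>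
          ⟨(Finset.mem_filter.1 h1).1, lt_of_le_of_ne (Finset.min'_le _ _ h1) (Ne.symm h2)⟩⟩
        exact absurd (hDsub h) (not_le.2 h2)
      rw [this, Set.ncard_coe_finset, Finset.card_erase_of_mem hfF', hn]
      rfl
    have meets : ∀ C' : Set Ω, IsClopen C' → IsSupportedOn (F : Set E) C' → (X ∩ C').Nonempty →
        (X₁ ∩ C').Nonempty := fun C' hC' hC'F hXC' =>
      hX.inter_nonempty hE hEc hD hfD hX₁ hX₁X hC' hC'F hfF hfmin F.finite_toSet hXC'
    by_contra! hno
    -- On `X₁` finitely many `k ∈ Q` suffice. If `y` had no translate in `C`, the clopen set of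
    -- points that no `k ∈ Q` moves into `C` would meet `X`. It has the same support `F`, so it
    -- would meet `X₁` too, a contradiction.
    obtain ⟨Q, hQ⟩ := hX₁.isClosed.isCompact.elim_finite_subcover
      (fun k : E → Multiplicative ℤ => {x | k • x ∈ C})
      (fun k => hC.isOpen.preimage (continuous_const_smul k)) (fun x hx => by
        obtain ⟨k, hk⟩ := ih (Or.inr ⟨f, rfl⟩) hX₁ hC hCF hcard (meets C hC hCF hXC) hx
        exact Set.mem_iUnion.2 ⟨k, hk⟩)
    have hC'eq : {x | ∀ k ∈ Q, k • x ∉ C} = ⋂ k ∈ Q, {x | k • x ∈ C}ᶜ := by ext; simp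
    obtain ⟨x, hx, hxC⟩ := meets {x | ∀ k ∈ Q, k • x ∉ C}
      (by
        rw [hC'eq]
        exact isClopen_biInter_finset fun k _ =>
          (hC.preimage (continuous_const_smul k)).compl)
      ⟨fun k hk x => forall₂_congr fun q _ => not_congr (by
          rw [← mul_smul]
          exact hCF.smul_mem_congr (fun e he => by simp [hk e he]) x),
        fun h hh x => forall₂_congr fun q _ => not_congr (hCF.smul_smul_mem hh q x)⟩
      ⟨y, hy, fun k _ => hno k⟩
    obtain ⟨k, hk, hxk⟩ := Set.mem_iUnion₂.1 (hQ hx)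
    exact hxC k hk hxk

theorem eventually_forall_smul_mem_iff {G Ω : Type*} [Group G] [TopologicalSpace G]
    [TopologicalSpace Ω] [CompactSpace Ω] [MulAction G Ω] [ContinuousSMul G Ω] {C : Set Ω}
    (hC : IsClopen C) : ∀ᶠ g in 𝓝 (1 : G), ∀ x : Ω, g • x ∈ C ↔ x ∈ C := by
  have : ∀ᶠ g in 𝓝 (1 : G), ∀ x ∈ (Set.univ : Set Ω), (g • x ∈ C ↔ x ∈ C) := by
    refine isCompact_univ.eventually_forall_of_forall_eventually fun x _ => ?_
    have hcont : Continuous fun z : G × Ω => z.1 • z.2 := continuous_fst.smul continuous_snd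
    by_cases hx : x ∈ C
    · filter_upwards [hcont.continuousAt.eventually (hC.isOpen.mem_nhds
        (by simpa using hx : (1 : G) • x ∈ C)),
        (continuous_snd.tendsto ((1 : G), x)).eventually (hC.isOpen.mem_nhds hx)]
        with z h1 h2
      exact iff_of_true h1 h2
    · filter_upwards [hcont.continuousAt.eventually (hC.compl.isOpen.mem_nhds
        (by simpa using hx : (1 : G) • x ∈ Cᶜ)),
        (continuous_snd.tendsto ((1 : G), x)).eventually (hC.compl.isOpen.mem_nhds hx)]
        with z h1 h2
      exact iff_of_false h1 h2
  filter_upwards [this] with g hg x using hg x (Set.mem_univ x)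

theorem exists_finset_subset_of_mem_nhds_one {E : Type*} {s : Set (E → Multiplicative ℤ)} (hs : s ∈ 𝓝 1) :
    ∃ F : Finset E, ∀ k : E → Multiplicative ℤ, (∀ e ∈ F, k e = 1) → k ∈ s := by
  rw [nhds_pi, Filter.mem_pi] at hs
  obtain ⟨I, hI, r, hr, hrt⟩ := hs
  refine ⟨hI.toFinset, fun k hk => hrt fun e he => ?_⟩
  rw [hk e (by simpa using he)]
  exact mem_of_mem_nhds (hr e)

omit [T2Space Ω] in
theorem exists_isSupportedOn {C : Set Ω} (hC : IsClopen C) :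
    ∃ F : Finset E, IsSupportedOn (F : Set E) C := by
  classical
  obtain ⟨F₁, h1⟩ := exists_finset_subset_of_mem_nhds_one
    (eventually_forall_smul_mem_iff (G := E → Multiplicative ℤ) hC)
  obtain ⟨F₂, h2⟩ := exists_fixes_subset_of_mem_nhds_one
    (eventually_forall_smul_mem_iff (G := Aut E) hC)
  exact ⟨F₁ ∪ F₂, fun k hk => h1 k fun e he => hk e (by simp [he]),
    fun h hh => h2 h fun e he => hh e (by simp at he; simp [he])⟩

/-- In a zero-dimensional flow of the semidirect product, the minimal sets are minimal for
`ℤ ^ E`. -/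
theorem IsMinimalInvariantSet.eq_of_smul_mem [TotallyDisconnectedSpace Ω] [SemidirectAction E Ω]
    (hE : IsEtaOne E) (hEc : #E ≤ ℵ₁) {X : Set Ω} (hX : IsMinimalInvariantSet (∅ : Set E) X)
    {Z : Set Ω} (hZX : Z ⊆ X) (hZc : IsClosed Z) (hZn : Z.Nonempty)
    (hZ : ∀ k : E → Multiplicative ℤ, ∀ x ∈ Z, k • x ∈ Z) : Z = X := by
  refine hZX.antisymm fun x hx => ?_
  by_contra hxZ
  obtain ⟨C, hC, hxC, hCZ⟩ := compact_exists_isClopen_in_isOpen hZc.isOpen_compl hxZ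
  obtain ⟨F, hF⟩ := exists_isSupportedOn (E := E) hC
  obtain ⟨y, hy⟩ := hZn
  obtain ⟨k, hk⟩ := hX.exists_smul_mem hE hEc _ (Or.inl rfl) hC F hF rfl ⟨x, hx, hxC⟩ (hZX hy)
  exact hCZ hk (hZ k y hy)

end Flow

/-! ### The greatest ambit of `ℤ ^ E` -/

section Ambit

variable {E : Type u}

/-- The sets `B ⊆ ℤ ^ E` that depend on finitely many coordinates only. -/
def Cylinder (E : Type u) : Type u :=
  {B : Set (E → Multiplicative ℤ) //
    ∃ F : Finset E, ∀ k k' : E → Multiplicative ℤ, (∀ e ∈ F, k e = k' e) → (k ∈ B ↔ k' ∈ B)}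

/-- The preimage of a cylinder under the translation by `k`. -/
def Cylinder.translate (k : E → Multiplicative ℤ) (B : Cylinder E) : Cylinder E :=
  ⟨{y | k * y ∈ B.1}, by
    obtain ⟨F, hF⟩ := B.2
    exact ⟨F, fun y y' h => hF _ _ fun e he => by simp [h e he]⟩⟩

/-- The preimage of a cylinder under the permutation of the coordinates by `h`. -/
def Cylinder.permute [LinearOrder E] (h : Aut E) (B : Cylinder E) : Cylinder E :=
  ⟨{y | permuteCoordinates E h y ∈ B.1}, by
    classical
    obtain ⟨F, hF⟩ := B.2
    refine ⟨F.image (h⁻¹ : Aut E), fun y y' hy => hF _ _ fun e he => ?_⟩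
    rw [permuteCoordinates_apply, permuteCoordinates_apply]
    exact hy _ (Finset.mem_image_of_mem _ he)⟩

/-- The compact space of all `Bool`-valued functions on the cylinders. -/
def CylinderSpace (E : Type u) : Type u := Cylinder E → Bool

namespace CylinderSpace

instance : TopologicalSpace (CylinderSpace E) := inferInstanceAs (TopologicalSpace (_ → Bool))
instance : CompactSpace (CylinderSpace E) := inferInstanceAs (CompactSpace (_ → Bool))
instance : T2Space (CylinderSpace E) := inferInstanceAs (T2Space (_ → Bool))
instance : TotallyDisconnectedSpace (CylinderSpace E) :=
  inferInstanceAs (TotallyDisconnectedSpace (_ → Bool))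

instance : MulAction (E → Multiplicative ℤ) (CylinderSpace E) where
  smul k x := fun B => x (B.translate k)
  one_smul x := funext fun B => congrArg x (Subtype.ext (by ext; simp [Cylinder.translate]))
  mul_smul k k' x := funext fun B => congrArg x (Subtype.ext (by
    ext; simp [Cylinder.translate, mul_assoc]))

instance [LinearOrder E] : MulAction (Aut E) (CylinderSpace E) where
  smul h x := fun B => x (B.permute h)
  one_smul x := funext fun B => congrArg x (Subtype.ext (by ext; simp [Cylinder.permute]))
  mul_smul h h' x := funext fun B => congrArg x (Subtype.ext (by ext; simp [Cylinder.permute]))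

theorem smul_apply (k : E → Multiplicative ℤ) (x : CylinderSpace E) (B : Cylinder E) :
    (k • x) B = x (B.translate k) := rfl

theorem aut_smul_apply [LinearOrder E] (h : Aut E) (x : CylinderSpace E) (B : Cylinder E) :
    (h • x) B = x (B.permute h) := rfl

instance [LinearOrder E] : SemidirectAction E (CylinderSpace E) where
  smul_smul_eq h k x := funext fun B => congrArg x (Subtype.ext (by
    ext y
    change permuteCoordinates E h (k * y) ∈ B.1 ↔
      permuteCoordinates E h k * permuteCoordinates E h y ∈ B.1
    rw [map_mul]))

instance : ContinuousSMul (E → Multiplicative ℤ) (CylinderSpace E) where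
  continuous_smul := by
    refine continuous_pi fun B => continuous_iff_continuousAt.2 fun ⟨k, x⟩ => ?_
    obtain ⟨F, hF⟩ := B.2
    have hk : ∀ᶠ k' : E → Multiplicative ℤ in 𝓝 k, ∀ e ∈ F, k' e = k e :=
      (Filter.eventually_all_finset F).2 fun e _ =>
        (continuous_apply e).continuousAt.eventually ((isOpen_discrete {k e}).mem_nhds rfl)
    have hcont : Continuous fun q : (E → Multiplicative ℤ) × CylinderSpace E =>
        q.2 (B.translate k) := (continuous_apply (B.translate k)).comp continuous_snd
    refine hcont.continuousAt.congr ?_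
    filter_upwards [(continuous_fst.tendsto (k, x)).eventually hk] with q hq
    rw [smul_apply]
    refine congrArg q.2 (Subtype.ext ?_)
    ext y
    exact hF _ _ fun e he => by simp [hq e he]

instance [LinearOrder E] : ContinuousSMul (Aut E) (CylinderSpace E) where
  continuous_smul := by
    refine continuous_pi fun B => continuous_iff_continuousAt.2 fun ⟨h, x⟩ => ?_
    obtain ⟨F, hF⟩ := B.2
    have hh : ∀ᶠ h' : Aut E in 𝓝 h, ∀ e ∈ F, h'⁻¹ e = h⁻¹ e :=
      (Filter.eventually_all_finset F).2 fun e _ =>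
        (continuous_inv.tendsto h).eventually (eventually_apply_eq h⁻¹ e)
    have hcont : Continuous fun q : Aut E × CylinderSpace E =>
        q.2 (B.permute h) := (continuous_apply (B.permute h)).comp continuous_snd
    refine hcont.continuousAt.congr ?_
    filter_upwards [(continuous_fst.tendsto (h, x)).eventually hh] with q hq
    rw [aut_smul_apply]
    refine congrArg q.2 (Subtype.ext ?_)
    ext y
    refine hF _ _ fun e he => ?_
    rw [permuteCoordinates_apply, permuteCoordinates_apply, hq e he]

open Classical in
/-- The principal ultrafilter at the neutral element. -/
noncomputable def base (E : Type u) : CylinderSpace E := fun B => decide (1 ∈ B.1)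

theorem base_apply (B : Cylinder E) : base E B = true ↔ 1 ∈ B.1 := by
  classical
  exact decide_eq_true_iff

theorem smul_base_apply (k : E → Multiplicative ℤ) (B : Cylinder E) :
    (k • base E) B = true ↔ k ∈ B.1 := by
  rw [smul_apply, base_apply]
  change k * 1 ∈ B.1 ↔ _
  rw [mul_one]

theorem aut_smul_base [LinearOrder E] (h : Aut E) : h • base E = base E := by
  funext B
  rw [aut_smul_apply, Bool.eq_iff_iff, base_apply, base_apply]
  change permuteCoordinates E h 1 ∈ B.1 ↔ _
  rw [map_one]

end CylinderSpace

/-- The restriction of an action to an invariant set. -/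
@[reducible]
def invariantSubsetAction {G Ω : Type*} [Group G] [MulAction G Ω] (X : Set Ω)
    (hX : ∀ g : G, ∀ x ∈ X, g • x ∈ X) : MulAction G X where
  smul g x := ⟨g • x.1, hX g x.1 x.2⟩
  one_smul x := Subtype.ext (one_smul G x.1)
  mul_smul g h x := Subtype.ext (mul_smul g h x.1)

theorem invariantSubsetAction_continuousSMul {G Ω : Type*} [Group G] [TopologicalSpace G]
    [TopologicalSpace Ω] [MulAction G Ω] [ContinuousSMul G Ω] (X : Set Ω)
    (hX : ∀ g : G, ∀ x ∈ X, g • x ∈ X) :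
    let _ := invariantSubsetAction X hX
    ContinuousSMul G X :=
  let _ := invariantSubsetAction X hX
  ⟨(continuous_fst.smul (continuous_subtype_val.comp continuous_snd)).subtype_mk _⟩

/-- The closure of the orbit of the base point. -/
def ambitSet (E : Type u) : Set (CylinderSpace E) :=
  closure (Set.range fun k : E → Multiplicative ℤ => k • CylinderSpace.base E)

/-- The greatest ambit of `ℤ ^ E`. -/
def Ambit (E : Type u) : Type u := ambitSet E

namespace Ambit

instance : TopologicalSpace (Ambit E) := inferInstanceAs (TopologicalSpace (ambitSet E))
instance : CompactSpace (Ambit E) :=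
  isCompact_iff_compactSpace.1 (isClosed_closure : IsClosed (ambitSet E)).isCompact
instance : T2Space (Ambit E) := inferInstanceAs (T2Space (ambitSet E))
instance : TotallyDisconnectedSpace (Ambit E) :=
  inferInstanceAs (TotallyDisconnectedSpace (ambitSet E))

theorem smul_mem (k : E → Multiplicative ℤ) (x : CylinderSpace E) (hx : x ∈ ambitSet E) :
    k • x ∈ ambitSet E := by
  refine map_mem_closure (continuous_const_smul k) hx ?_
  rintro _ ⟨k', rfl⟩
  exact ⟨k * k', mul_smul k k' _⟩

theorem aut_smul_mem [LinearOrder E] (h : Aut E) (x : CylinderSpace E) (hx : x ∈ ambitSet E) :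
    h • x ∈ ambitSet E := by
  refine map_mem_closure (continuous_const_smul h) hx ?_
  rintro _ ⟨k', rfl⟩
  refine ⟨permuteCoordinates E h k', ?_⟩
  simp only
  rw [SemidirectAction.smul_smul_eq, CylinderSpace.aut_smul_base]

instance : MulAction (E → Multiplicative ℤ) (Ambit E) :=
  invariantSubsetAction (ambitSet E) smul_mem
instance [LinearOrder E] : MulAction (Aut E) (Ambit E) := invariantSubsetAction (ambitSet E) aut_smul_mem
instance : ContinuousSMul (E → Multiplicative ℤ) (Ambit E) :=
  invariantSubsetAction_continuousSMul (ambitSet E) smul_mem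
instance [LinearOrder E] : ContinuousSMul (Aut E) (Ambit E) :=
  invariantSubsetAction_continuousSMul (ambitSet E) aut_smul_mem
instance [LinearOrder E] : SemidirectAction E (Ambit E) where
  smul_smul_eq h k x := Subtype.ext (SemidirectAction.smul_smul_eq h k x.1)

/-- The base point of the greatest ambit. -/
noncomputable def base (E : Type u) : Ambit E :=
  ⟨CylinderSpace.base E, subset_closure ⟨1, one_smul _ _⟩⟩

theorem aut_smul_base [LinearOrder E] (h : Aut E) : h • base E = base E :=
  Subtype.ext (CylinderSpace.aut_smul_base h)

theorem denseRange_smul_base : DenseRange fun k : E → Multiplicative ℤ => k • base E := by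
  intro x
  refine closure_subtype.2 ?_
  have h : (fun y : Ambit E => y.1) '' Set.range (fun k : E → Multiplicative ℤ => k • base E) =
      Set.range fun k : E → Multiplicative ℤ => k • CylinderSpace.base E := by
    rw [← Set.range_comp]
    rfl
  have hx : x.1 ∈ closure (Set.range fun k : E → Multiplicative ℤ => k • CylinderSpace.base E) :=
    x.2
  rw [← h] at hx
  exact hx

/-- The closure `Γ` of the orbit of `(base E, y₀)` is the graph of the extension. The point is that
cylinders suffice to separate: two values over one `x` would be distinguished by a cylinder. -/
theorem exists_continuous_extension {Y : Type*} [TopologicalSpace Y] [CompactSpace Y] [T2Space Y]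
    [MulAction (E → Multiplicative ℤ) Y] [ContinuousSMul (E → Multiplicative ℤ) Y] (y₀ : Y) :
    ∃ ρ : Ambit E → Y, Continuous ρ ∧ ρ (base E) = y₀ ∧
      ∀ (k : E → Multiplicative ℤ) (x : Ambit E), ρ (k • x) = k • ρ x := by
  let Γ : Set (Ambit E × Y) :=
    closure (Set.range fun k : E → Multiplicative ℤ => (k • base E, k • y₀))
  have hΓ : IsClosed Γ := isClosed_closure
  have hmem : ∀ k : E → Multiplicative ℤ, (k • base E, k • y₀) ∈ Γ :=
    fun k => subset_closure ⟨k, rfl⟩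
  have hinj : ∀ x y y', (x, y) ∈ Γ → (x, y') ∈ Γ → y = y' := by
    intro x y y' h h'
    by_contra hne
    obtain ⟨P, P', hP, hP', hy, hy', hdisj⟩ := t2_separation hne
    have hcont : Continuous fun q : (E → Multiplicative ℤ) × Y => q.1 • q.2 :=
      continuous_fst.smul continuous_snd
    have h1 : ∀ᶠ q : (E → Multiplicative ℤ) × Y in 𝓝 1 ×ˢ 𝓝 y, q.1 • q.2 ∈ P := by
      rw [← nhds_prod_eq]
      exact hcont.continuousAt.eventually (hP.mem_nhds (by simpa using hy))
    obtain ⟨A, hA, O, hO, hAO⟩ := Filter.eventually_prod_iff.1 h1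
    obtain ⟨F, hF⟩ := exists_finset_subset_of_mem_nhds_one hA
    -- Thickening the return set of `O` by the neighbourhood `{v | v = 1 on F}` makes it a cylinder,
    -- and `F` is small enough that `k ∈ B` still forces `k • y₀ ∈ P`.
    let B : Cylinder E := ⟨{k | ∃ v : E → Multiplicative ℤ, (∀ e ∈ F, v e = 1) ∧ O (v • k • y₀)},
      F, by
        have aux : ∀ k k' : E → Multiplicative ℤ, (∀ e ∈ F, k e = k' e) →
            (∃ v : E → Multiplicative ℤ, (∀ e ∈ F, v e = 1) ∧ O (v • k • y₀)) →
            ∃ v : E → Multiplicative ℤ, (∀ e ∈ F, v e = 1) ∧ O (v • k' • y₀) := by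
          rintro k k' hkk' ⟨v, hv, hO⟩
          refine ⟨v * (k * k'⁻¹), fun e he => by simp [hv e he, hkk' e he], ?_⟩
          rwa [← mul_smul, mul_assoc, inv_mul_cancel_right, mul_smul]
        exact fun k k' hkk' => ⟨aux k k' hkk', aux k' k fun e he => (hkk' e he).symm⟩⟩
    have hev : Continuous fun z : Ambit E => z.1 B :=
      (continuous_apply B).comp continuous_subtype_val
    by_cases hB : x.1 B = true
    · obtain ⟨_, ⟨hkB, hkP⟩, k, rfl⟩ := mem_closure_iff_nhds.1 h' _ (prod_mem_nhds
        (hev.continuousAt.eventually ((isOpen_discrete {true}).mem_nhds hB))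
        (hP'.mem_nhds hy'))
      obtain ⟨v, hv, hO'⟩ := (CylinderSpace.smul_base_apply k B).1 hkB
      have := hAO (hF v⁻¹ fun e he => by simp [hv e he]) hO'
      simp only [inv_smul_smul] at this
      exact Set.disjoint_left.1 hdisj this hkP
    · obtain ⟨_, ⟨hkB, hkO⟩, k, rfl⟩ := mem_closure_iff_nhds.1 h _ (prod_mem_nhds
        (hev.continuousAt.eventually ((isOpen_discrete {true}ᶜ).mem_nhds hB)) hO)
      refine hkB ((CylinderSpace.smul_base_apply k B).2 ⟨1, fun _ _ => rfl, ?_⟩)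
      rw [one_smul]
      exact hkO
  have : CompactSpace Γ := isCompact_iff_compactSpace.1 hΓ.isCompact
  have hfst : Continuous fun q : Γ => q.1.1 := continuous_fst.comp continuous_subtype_val
  have hbij : Function.Bijective fun q : Γ => q.1.1 := by
    constructor
    · rintro ⟨⟨x, y⟩, hq⟩ ⟨⟨x', y'⟩, hq'⟩ (rfl : x = x')
      exact Subtype.ext (Prod.ext rfl (hinj x y y' hq hq'))
    · rw [← Set.range_eq_univ]
      refine (isCompact_range hfst).isClosed.closure_eq.symm.trans ?_
      refine Set.eq_univ_of_univ_subset ?_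
      rw [← denseRange_smul_base.closure_range]
      refine closure_mono ?_
      rintro _ ⟨k, rfl⟩
      exact ⟨⟨_, hmem k⟩, rfl⟩
  let e : Γ ≃ₜ Ambit E :=
    Continuous.homeoOfEquivCompactToT2 (f := Equiv.ofBijective _ hbij) hfst
  have hρ : Continuous fun x : Ambit E => (e.symm x).1.2 :=
    continuous_snd.comp (continuous_subtype_val.comp e.symm.continuous)
  have hval : ∀ k : E → Multiplicative ℤ, (e.symm (k • base E)).1.2 = k • y₀ := by
    intro k
    have : e.symm (k • base E) = ⟨_, hmem k⟩ := e.symm_apply_eq.2 rfl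
    rw [this]
  refine ⟨fun x => (e.symm x).1.2, hρ, ?_, fun k x => ?_⟩
  · simpa using hval 1
  · have := denseRange_smul_base.equalizer (hρ.comp (continuous_const_smul k))
      ((continuous_const_smul k).comp hρ) (funext fun k' => by
        simp only [Function.comp_apply]
        rw [← mul_smul, hval, hval, mul_smul])
    exact congrFun this x

theorem eq_of_map_base {Y : Type*} [TopologicalSpace Y] [T2Space Y]
    [MulAction (E → Multiplicative ℤ) Y] {f g : Ambit E → Y} (hf : Continuous f)
    (hg : Continuous g) (hfk : ∀ (k : E → Multiplicative ℤ) x, f (k • x) = k • f x)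
    (hgk : ∀ (k : E → Multiplicative ℤ) x, g (k • x) = k • g x) (h : f (base E) = g (base E)) :
    f = g :=
  denseRange_smul_base.equalizer hf hg (funext fun k => by
    simp only [Function.comp_apply]
    rw [hfk, hgk, h])

/-- A minimal subflow of the greatest ambit is coalescent. -/
theorem injOn_of_minimal {X : Set (Ambit E)} (hXc : IsClosed X) (hXn : X.Nonempty)
    (hX : ∀ k : E → Multiplicative ℤ, ∀ x ∈ X, k • x ∈ X)
    (hmin : ∀ Z ⊆ X, IsClosed Z → Z.Nonempty →
      (∀ k : E → Multiplicative ℤ, ∀ x ∈ Z, k • x ∈ Z) → Z = X)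
    {φ : Ambit E → Ambit E} (hφ : ContinuousOn φ X) (hφX : Set.MapsTo φ X X)
    (hφk : ∀ (k : E → Multiplicative ℤ), ∀ x ∈ X, φ (k • x) = k • φ x) : Set.InjOn φ X := by
  choose ρ hρc hρb hρk using fun t : Ambit E => exists_continuous_extension (E := E) t
  -- This is the associativity of the ambit semigroup `s * t = ρ t s`, in which `X` is closed under
  -- multiplication and compact.
  have hassoc : ∀ t s x, ρ t (ρ s x) = ρ (ρ t s) x := fun t s x =>
    congrFun (eq_of_map_base ((hρc t).comp (hρc s)) (hρc (ρ t s))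
      (fun k x => by simp only [Function.comp_apply]; rw [hρk, hρk]) (hρk _)
      (by simp only [Function.comp_apply]; rw [hρb, hρb])) x
  have hρX : ∀ t ∈ X, ∀ s, ρ t s ∈ X := by
    intro t ht s
    rw [← hXc.closure_eq]
    refine map_mem_closure (hρc t) (denseRange_smul_base s) ?_
    rintro _ ⟨k, rfl⟩
    rw [hρk, hρb]
    exact hX k t ht
  have hsurj : ∀ t ∈ X, ∀ s ∈ X, ∃ r ∈ X, ρ t r = s := by
    intro t ht s hs
    have : ρ t '' X = X := by
      refine hmin _ ?_ (hXc.isCompact.image (hρc t)).isClosed (hXn.image _) ?_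
      · rintro _ ⟨x, -, rfl⟩
        exact hρX t ht x
      · rintro k _ ⟨x, hx, rfl⟩
        exact ⟨k • x, hX k x hx, hρk t k x⟩
    rwa [← this] at hs
  let _ : Semigroup (Ambit E) :=
    { mul := fun s t => ρ t s
      mul_assoc := fun a b c => hassoc c b a }
  obtain ⟨w, hwX, hw⟩ := exists_idempotent_in_compact_subsemigroup (M := Ambit E)
    (fun r => hρc r) X hXn hXc.isCompact fun x _ y hy => hρX y hy x
  have hw' : ρ w w = w := hw
  have hid : ∀ x ∈ X, ρ w x = x := by
    have : X ∩ {x | ρ w x = x} = X := by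
      refine hmin _ Set.inter_subset_left (hXc.inter (isClosed_eq (hρc w) continuous_id))
        ⟨w, hwX, hw'⟩ ?_
      rintro k x ⟨hx, hxw⟩
      refine ⟨hX k x hx, ?_⟩
      change ρ w (k • x) = k • x
      rw [hρk, hxw]
    intro x hx
    rw [← this] at hx
    exact hx.2
  set a := φ w
  have haX : a ∈ X := hφX hwX
  have hφρ : ∀ x ∈ X, φ x = ρ a x := by
    have : X ∩ {x | φ x = ρ a x} = X := by
      -- `φ` is continuous only on `X`. Precomposing with `ρ w`, which maps the ambit into `X` and
      -- is the identity on `X`, gives a map continuous everywhere.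
      have hgr : IsClosed {x : Ambit E | φ (ρ w x) = ρ a x} := by
        refine isClosed_eq ?_ (hρc a)
        exact hφ.comp_continuous (hρc w) fun x => hρX w hwX x
      have heq : X ∩ {x | φ x = ρ a x} = X ∩ {x : Ambit E | φ (ρ w x) = ρ a x} := by
        ext x
        refine and_congr_right fun hx => ?_
        change φ x = ρ a x ↔ φ (ρ w x) = ρ a x
        rw [hid x hx]
      refine hmin _ Set.inter_subset_left (heq ▸ hXc.inter hgr) ?_ ?_
      · rw [heq]
        obtain ⟨x, hx⟩ := hXn
        have : (fun x => φ (ρ w x)) = ρ a := by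
          refine eq_of_map_base (hφ.comp_continuous (hρc w) fun x => hρX w hwX x) (hρc a)
            (fun k x => ?_) (hρk a) ?_
          · rw [hρk, hφk k _ (hρX w hwX x)]
          · rw [hρb, hρb]
        exact ⟨x, hx, congrFun this x⟩
      · rintro k x ⟨hx, hxw⟩
        refine ⟨hX k x hx, ?_⟩
        change φ (k • x) = ρ a (k • x)
        rw [hρk, hφk k x hx, hxw]
    intro x hx
    rw [← this] at hx
    exact hx.2
  -- As in a group with identity `w`, `ρ c` inverts `ρ a` on `X`: `c` is a one-sided inverse of `a`,
  -- `c'` one of `c`, and `ρ a` and `ρ c'` coincide on `X`.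
  obtain ⟨c, hcX, hc⟩ := hsurj a haX w hwX
  obtain ⟨c', hc'X, hc'⟩ := hsurj c hcX w hwX
  have hwa : ρ a w = c' := by
    rw [← hc', hassoc, hc, hid c' hc'X]
  have hleft : ∀ x ∈ X, ρ c (ρ a x) = x := by
    intro x hx
    have h1 : ρ a x = ρ c' x := by
      rw [← hwa, ← hassoc, hid x hx]
    rw [h1, hassoc, hc', hid x hx]
  intro x hx y hy hxy
  rw [hφρ x hx, hφρ y hy] at hxy
  rw [← hleft x hx, hxy, hleft y hy]

end Ambit

end Ambit

/-! ### Universal minimal flows of the semidirect product and of `ℤ ^ E` -/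

section UniversalMinimalFlow

theorem IsMinimalFlow.eq_univ {G : Type*} {Y : Type*} [Group G] [TopologicalSpace G]
    [IsTopologicalGroup G] [TopologicalSpace Y] [MulAction G Y] (hY : IsMinimalFlow G Y)
    {Z : Set Y} (hZ : IsClosed Z) (hZn : Z.Nonempty) (hZi : ∀ g : G, ∀ y ∈ Z, g • y ∈ Z) :
    Z = Set.univ := by
  have := hY.continuousSMul
  have := hY.minimal
  refine (eq_empty_or_univ_of_smul_invariant_closed G hZ fun g => ?_).resolve_left hZn.ne_empty
  rintro _ ⟨y, hy, rfl⟩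
  exact hZi g y hy

theorem exists_homeomorph_of_comp_injective {X Y Z : Type*} [TopologicalSpace X] [CompactSpace X]
    [TopologicalSpace Y] [T2Space Y] {f : X → Y} (hf : Continuous f)
    (hfs : Function.Surjective f) {g : Y → Z} (hgf : Function.Injective (g ∘ f)) :
    ∃ e : X ≃ₜ Y, ∀ x, e x = f x :=
  ⟨Continuous.homeoOfEquivCompactToT2
    (f := Equiv.ofBijective f ⟨hgf.of_comp, hfs⟩) hf, fun _ => rfl⟩

variable {E : Type u} [LinearOrder E] {G : Type u} [Group G] [TopologicalSpace G]
  [IsTopologicalGroup G]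

theorem continuous_inl_semidirect :
    Continuous (SemidirectProduct.inl :
      (E → Multiplicative ℤ) → (E → Multiplicative ℤ) ⋊[permuteCoordinates E] Aut E) :=
  continuous_induced_rng.2 (continuous_id.prodMk continuous_const)

theorem continuous_inr_semidirect :
    Continuous (SemidirectProduct.inr :
      Aut E → (E → Multiplicative ℤ) ⋊[permuteCoordinates E] Aut E) :=
  continuous_induced_rng.2 (continuous_const.prodMk continuous_id)

/-- A topological group isomorphic to the semidirect product has a universal minimal flow that is
also a universal minimal flow of `ℤ ^ E`, and every equivariant endomorphism of that flow over
`ℤ ^ E` is injective. -/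
theorem exists_isUniversalMinimalFlow (hE : IsEtaOne E) (hEc : #E ≤ ℵ₁)
    (Φ : G ≃ₜ* ((E → Multiplicative ℤ) ⋊[permuteCoordinates E] Aut E)) :
    ∃ (X : Type u) (_ : TopologicalSpace X) (_ : MulAction G X)
      (_ : MulAction (E → Multiplicative ℤ) X), IsUniversalMinimalFlow G X ∧
      IsUniversalMinimalFlow (E → Multiplicative ℤ) X ∧
      (∀ (k : E → Multiplicative ℤ) (x : X), Φ.symm (SemidirectProduct.inl k) • x = k • x) ∧
      ∀ φ : X → X, Continuous φ → (∀ (k : E → Multiplicative ℤ) (x : X), φ (k • x) = k • φ x) →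
        Function.Injective φ := by
  -- For `D = ∅` invariance refers to the whole semidirect product.
  obtain ⟨X, -, hX⟩ := exists_isMinimalInvariantSet (∅ : Set E) (isClosed_univ (X := Ambit E))
    ⟨Ambit.base E, Set.mem_univ _⟩ ⟨fun _ _ _ => Set.mem_univ _, fun _ _ _ _ => Set.mem_univ _⟩
  have hXK := hX.invariant.1
  have hXH : ∀ h : Aut E, ∀ x ∈ X, h • x ∈ X := fun h => hX.invariant.2 h fun _ he => he.elim
  have hmin : ∀ Z ⊆ X, IsClosed Z → Z.Nonempty →
      (∀ k : E → Multiplicative ℤ, ∀ x ∈ Z, k • x ∈ Z) → Z = X :=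
    fun Z hZX hZc hZn hZ => hX.eq_of_smul_mem hE hEc hZX hZc hZn hZ
  let _ : MulAction (E → Multiplicative ℤ) X := invariantSubsetAction X hXK
  let _ : MulAction (Aut E) X := invariantSubsetAction X hXH
  have : ContinuousSMul (E → Multiplicative ℤ) X := invariantSubsetAction_continuousSMul X hXK
  have : ContinuousSMul (Aut E) X := invariantSubsetAction_continuousSMul X hXH
  have : SemidirectAction E X := ⟨fun h k x => Subtype.ext (SemidirectAction.smul_smul_eq h k x.1)⟩
  have : CompactSpace X := isCompact_iff_compactSpace.1 hX.isClosed.isCompact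
  have hne : Nonempty X := hX.nonempty.to_subtype
  let actG : MulAction G X :=
    { smul := fun g x => (Φ g).left • (Φ g).right • x
      one_smul := fun x => by
        change (Φ 1).left • (Φ 1).right • x = x
        simp
      mul_smul := fun g h x => by
        change (Φ (g * h)).left • (Φ (g * h)).right • x =
          (Φ g).left • (Φ g).right • (Φ h).left • (Φ h).right • x
        rw [map_mul, SemidirectProduct.mul_left, SemidirectProduct.mul_right, mul_smul, mul_smul,
          SemidirectAction.smul_smul_eq (Φ g).right (Φ h).left] }
  have hsmul : ∀ (g : G) (x : X), g • x = (Φ g).left • (Φ g).right • x := fun _ _ => rfl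
  have hinl : ∀ (k : E → Multiplicative ℤ) (x : X),
      Φ.symm (SemidirectProduct.inl k) • x = k • x := by
    intro k x
    rw [hsmul, ContinuousMulEquiv.apply_symm_apply]
    simp
  have hcontG : ContinuousSMul G X := by
    have h1 : Continuous fun g : G => ((Φ g).left, (Φ g).right) :=
      continuous_induced_dom.comp Φ.continuous_toFun
    exact ⟨((continuous_fst.comp h1).comp continuous_fst).smul
      (((continuous_snd.comp h1).comp continuous_fst).smul continuous_snd)⟩
  have hminK : MulAction.IsMinimal (E → Multiplicative ℤ) X := by
    rw [isMinimal_iff_isClosed_smul_invariant]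
    intro s hs hinv
    rcases s.eq_empty_or_nonempty with h | h
    · exact Or.inl h
    · refine Or.inr (Set.eq_univ_of_forall fun x => ?_)
      have := hmin (Subtype.val '' s) (by rintro _ ⟨y, -, rfl⟩; exact y.2)
        (hX.isClosed.isClosedEmbedding_subtypeVal.isClosedMap s hs) (h.image _) (by
          rintro k _ ⟨y, hy, rfl⟩
          exact ⟨k • y, hinv k (Set.smul_mem_smul_set hy), rfl⟩)
      obtain ⟨y, hy, hyx⟩ := this.ge x.2
      rwa [← Subtype.ext hyx]
  have hminG : MulAction.IsMinimal G X := by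
    rw [isMinimal_iff_isClosed_smul_invariant]
    intro s hs hinv
    refine eq_empty_or_univ_of_smul_invariant_closed (E → Multiplicative ℤ) hs fun k => ?_
    rintro _ ⟨y, hy, rfl⟩
    simp only
    rw [← hinl]
    exact hinv _ (Set.smul_mem_smul_set hy)
  have hK : IsMinimalFlow (E → Multiplicative ℤ) X :=
    ⟨inferInstance, inferInstanceAs (T2Space X), hne, inferInstance, hminK⟩
  have hG : IsMinimalFlow G X := ⟨inferInstance, inferInstanceAs (T2Space X), hne, hcontG, hminG⟩
  refine ⟨X, inferInstance, actG, inferInstance, ⟨hG, ?_⟩, ⟨hK, ?_⟩, hinl, ?_⟩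
  · intro Y _ _ hY
    have := hY.compactSpace
    have := hY.t2Space
    have := hY.continuousSMul
    let _ : MulAction (E → Multiplicative ℤ) Y := MulAction.compHom Y
      (Φ.symm.toMonoidHom.comp SemidirectProduct.inl)
    let _ : MulAction (Aut E) Y := MulAction.compHom Y
      (Φ.symm.toMonoidHom.comp SemidirectProduct.inr)
    have hk : ∀ (k : E → Multiplicative ℤ) (y : Y),
      k • y = Φ.symm (SemidirectProduct.inl k) • y := fun _ _ => rfl
    have hh : ∀ (h : Aut E) (y : Y), h • y = Φ.symm (SemidirectProduct.inr h) • y :=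
      fun _ _ => rfl
    have hkh : ∀ (g : G) (y : Y), g • y = (Φ g).left • (Φ g).right • y := by
      intro g y
      rw [hk, hh, ← mul_smul, ← map_mul, SemidirectProduct.inl_left_mul_inr_right,
        ContinuousMulEquiv.symm_apply_apply]
    have : ContinuousSMul (E → Multiplicative ℤ) Y :=
      ⟨((Φ.symm.continuous_toFun.comp continuous_inl_semidirect).comp continuous_fst).smul
        continuous_snd⟩
    have : ContinuousSMul (Aut E) Y :=
      ⟨((Φ.symm.continuous_toFun.comp continuous_inr_semidirect).comp continuous_fst).smul
        continuous_snd⟩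
    have : SemidirectAction E Y := ⟨fun h k y => by
      rw [hh, hk, hk, hh, ← mul_smul, ← mul_smul, ← map_mul, ← map_mul,
        SemidirectProduct.inl_aut, mul_assoc _ _ (SemidirectProduct.inr h), ← map_mul,
        inv_mul_cancel, map_one, mul_one]⟩
    obtain ⟨z⟩ := hY.nonempty
    -- Extreme amenability of `Aut E` enters here: the base point and `y₀` are both fixed by `Aut
    -- E`, so the extension `ρ` is equivariant for `Aut E` as well.
    obtain ⟨y₀, -, hy₀⟩ := exists_fixed_point (Y := Y) hE hEc (Or.inl rfl) isClosed_univ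
      ⟨z, Set.mem_univ z⟩ fun _ _ _ _ => Set.mem_univ _
    obtain ⟨ρ, hρc, hρb, hρk⟩ := Ambit.exists_continuous_extension (E := E) y₀
    have hρh : ∀ (h : Aut E) (x : Ambit E), ρ (h • x) = h • ρ x := by
      intro h x
      have := Ambit.denseRange_smul_base.equalizer (hρc.comp (continuous_const_smul h))
        ((continuous_const_smul h).comp hρc) (funext fun k => by
          simp only [Function.comp_apply]
          rw [SemidirectAction.smul_smul_eq, Ambit.aut_smul_base, hρk, hρk, hρb,
            SemidirectAction.smul_smul_eq, hy₀ h fun _ he => he.elim])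
      exact congrFun this x
    have hπ : Continuous fun x : X => ρ x.1 := hρc.comp continuous_subtype_val
    have hπG : ∀ (g : G) (x : X), ρ (g • x).1 = g • ρ x.1 := by
      intro g x
      rw [hkh, hsmul]
      change ρ ((Φ g).left • (Φ g).right • x.1) = _
      rw [hρk, hρh]
    refine ⟨fun x => ρ x.1, hπ, hπG, Set.range_eq_univ.1 ?_⟩
    refine hY.eq_univ (isCompact_range hπ).isClosed (Set.range_nonempty _) ?_
    rintro g _ ⟨x, rfl⟩
    exact ⟨g • x, hπG g x⟩
  · intro Y _ _ hY
    have := hY.compactSpace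
    have := hY.t2Space
    have := hY.continuousSMul
    obtain ⟨y₀⟩ := hY.nonempty
    obtain ⟨ρ, hρc, -, hρk⟩ := Ambit.exists_continuous_extension (E := E) y₀
    have hπ : Continuous fun x : X => ρ x.1 := hρc.comp continuous_subtype_val
    refine ⟨fun x => ρ x.1, hπ, fun k x => hρk k x.1, Set.range_eq_univ.1 ?_⟩
    refine hY.eq_univ (isCompact_range hπ).isClosed (Set.range_nonempty _) ?_
    rintro k _ ⟨x, rfl⟩
    exact ⟨k • x, hρk k x.1⟩
  · intro φ hφ hφk
    classical
    let ψ : Ambit E → Ambit E := fun x => if hx : x ∈ X then φ ⟨x, hx⟩ else x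
    have hψ : ∀ x : X, ψ x.1 = φ x := fun x => dif_pos x.2
    have hinj := Ambit.injOn_of_minimal hX.isClosed hX.nonempty hXK hmin (φ := ψ)
      (continuousOn_iff_continuous_domRestrict.2 (by
        have : X.domRestrict ψ = fun x => (φ x).1 := funext hψ
        rw [this]
        exact continuous_subtype_val.comp hφ))
      (fun x hx => by rw [hψ ⟨x, hx⟩]; exact (φ _).2)
      (fun k x hx => by
        rw [hψ ⟨x, hx⟩, hψ ⟨k • x, hXK k x hx⟩]
        exact congrArg Subtype.val (hφk k ⟨x, hx⟩))
    intro x y hxy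
    exact Subtype.ext (hinj x.2 y.2 (by rw [hψ, hψ, hxy]))

/-- Both flows are compared with one model `M`. A surjection from `M` followed by a map back to `M`
is an endomorphism over `ℤ ^ E`, hence injective, so the surjection is a homeomorphism. -/
theorem universalMinimalFlow_homeomorph (hE : IsEtaOne E) (hEc : #E ≤ ℵ₁)
    (Φ : G ≃ₜ* ((E → Multiplicative ℤ) ⋊[permuteCoordinates E] Aut E)) :
    (∃ (X : Type u) (_ : TopologicalSpace X) (_ : MulAction G X), IsUniversalMinimalFlow G X) ∧
    (∃ (Y : Type u) (_ : TopologicalSpace Y) (_ : MulAction (E → Multiplicative ℤ) Y),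
      IsUniversalMinimalFlow (E → Multiplicative ℤ) Y) ∧
    ∀ (X : Type u) [TopologicalSpace X] [MulAction G X]
      (Y : Type u) [TopologicalSpace Y] [MulAction (E → Multiplicative ℤ) Y],
      IsUniversalMinimalFlow G X → IsUniversalMinimalFlow (E → Multiplicative ℤ) Y →
      ∃ F : X ≃ₜ Y, ∀ (k : E → Multiplicative ℤ) (x : X),
        F (Φ.symm (SemidirectProduct.inl k) • x) = k • F x := by
  obtain ⟨M, _, _, _, hMG, hMK, hM, hinj⟩ := exists_isUniversalMinimalFlow hE hEc Φ
  refine ⟨⟨M, _, _, hMG⟩, ⟨M, _, _, hMK⟩, fun X _ _ Y _ _ hX hY => ?_⟩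
  have := hMG.isMinimalFlow.compactSpace
  have := hX.isMinimalFlow.t2Space
  have := hY.isMinimalFlow.t2Space
  obtain ⟨σ, hσ, hσG, hσs⟩ := hMG.universal X hX.isMinimalFlow
  obtain ⟨π, hπ, hπG, -⟩ := hX.universal M hMG.isMinimalFlow
  obtain ⟨τ, hτ, hτK, hτs⟩ := hMK.universal Y hY.isMinimalFlow
  obtain ⟨ω, hω, hωK, -⟩ := hY.universal M hMK.isMinimalFlow
  obtain ⟨e₁, he₁⟩ := exists_homeomorph_of_comp_injective hσ hσs
    (hinj (π ∘ σ) (hπ.comp hσ) fun k x => by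
      simp only [Function.comp_apply]
      rw [← hM, hσG, hπG, hM])
  obtain ⟨e₂, he₂⟩ := exists_homeomorph_of_comp_injective hτ hτs
    (hinj (ω ∘ τ) (hω.comp hτ) fun k x => by
      simp only [Function.comp_apply]
      rw [hτK, hωK])
  refine ⟨e₁.symm.trans e₂, fun k x => ?_⟩
  obtain ⟨m, rfl⟩ := e₁.surjective x
  have : Φ.symm (SemidirectProduct.inl k) • e₁ m = e₁ (k • m) := by
    rw [he₁, he₁, ← hσG, hM]
  rw [this]
  simp only [Homeomorph.trans_apply, Homeomorph.symm_apply_apply]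
  rw [he₂, he₂, hτK]

end UniversalMinimalFlow

/-! ### Ultraproducts of finite linear orders -/

/-- The order-theoretic properties of an infinite ultraproduct of finite linear orders that are
needed here: endpoints, immediate successors and predecessors, and `ℵ₁`-saturation with respect to
the relation "the interval between `a` and `b` is infinite". -/
structure IsPseudofiniteOrder (M : Type u) [LinearOrder M] : Prop where
  exists_bot : ∃ b : M, ∀ x, b ≤ x
  exists_top : ∃ b : M, ∀ x, x ≤ b
  exists_covBy_right : ∀ a c : M, a < c → ∃ b, a ⋖ b
  exists_covBy_left : ∀ a c : M, c < a → ∃ b, b ⋖ a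
  exists_infinite_Icc : ∀ A B : Set M, A.Countable → B.Countable → A.Nonempty → B.Nonempty →
    (∀ a ∈ A, ∀ b ∈ B, (Set.Icc a b).Infinite) →
    ∃ x, (∀ a ∈ A, (Set.Icc a x).Infinite) ∧ ∀ b ∈ B, (Set.Icc x b).Infinite

theorem exists_ncard_Icc_ge {M : Type*} [LinearOrder M] [Finite M] {a b : M} {n : ℕ}
    (h : 2 * n + 1 ≤ (Set.Icc a b).ncard) :
    ∃ z, n ≤ (Set.Icc a z).ncard ∧ n ≤ (Set.Icc z b).ncard := by
  classical
  have hfin : (Set.Icc a b).Finite := Set.toFinite _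
  set S := hfin.toFinset with hS
  have hk : (Set.Icc a b).ncard = S.card := Set.ncard_eq_toFinset_card _ hfin
  rw [hk] at h
  let g := S.orderEmbOfFin rfl
  have hg : ∀ i, g i ∈ Set.Icc a b := fun i => by
    have : g i ∈ S := Finset.orderEmbOfFin_mem _ _ _
    simpa [hS] using this
  let m : Fin S.card := ⟨n, by omega⟩
  refine ⟨g m, ?_, ?_⟩
  · have h1 : (g '' Set.Iic m).ncard = n + 1 := by
      rw [Set.ncard_image_of_injective _ g.injective, Set.ncard_eq_toFinset_card',
        Set.toFinset_Iic, Fin.card_Iic]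
    refine le_trans (by omega) (Set.ncard_le_ncard (s := g '' Set.Iic m) ?_ (Set.toFinite _))
    rintro _ ⟨i, hi, rfl⟩
    exact ⟨(hg i).1, g.monotone hi⟩
  · have h1 : (g '' Set.Ici m).ncard = S.card - n := by
      rw [Set.ncard_image_of_injective _ g.injective, Set.ncard_eq_toFinset_card',
        Set.toFinset_Ici, Fin.card_Ici]
    refine le_trans (by omega) (Set.ncard_le_ncard (s := g '' Set.Ici m) ?_ (Set.toFinite _))
    rintro _ ⟨i, hi, rfl⟩
    exact ⟨g.monotone hi, (hg i).2⟩

/-! ### Cardinalities of intervals and saturation of the ultraproduct. -/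

namespace Ultraproduct

variable (D : Ultrafilter ℕ) {L : ℕ → Type u}

/-- The class of a sequence in the ultraproduct. -/
def mk (a : ∀ t, L t) : Ultraproduct D L := Quotient.mk _ a

theorem mk_surjective : Function.Surjective (mk D : (∀ t, L t) → Ultraproduct D L) :=
  Quotient.mk_surjective

theorem mk_eq_mk {a b : ∀ t, L t} : mk D a = mk D b ↔ ∀ᶠ t in (D : Filter ℕ), a t = b t :=
  Quotient.eq

variable [∀ t, LinearOrder (L t)]

theorem mk_le_mk {a b : ∀ t, L t} : mk D a ≤ mk D b ↔ ∀ᶠ t in (D : Filter ℕ), a t ≤ b t :=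
  Iff.rfl

theorem mk_lt_mk {a b : ∀ t, L t} : mk D a < mk D b ↔ ∀ᶠ t in (D : Filter ℕ), a t < b t := by
  rw [← not_le, mk_le_mk, ← Ultrafilter.eventually_not]
  simp only [not_le]

theorem mk_covBy_mk {a b : ∀ t, L t} (h : ∀ᶠ t in (D : Filter ℕ), a t ⋖ b t) :
    mk D a ⋖ mk D b := by
  refine ⟨(mk_lt_mk D).2 (h.mono fun t ht => ht.lt), fun c hac hcb => ?_⟩
  obtain ⟨c, rfl⟩ := mk_surjective D c
  obtain ⟨t, ht, h1, h2⟩ := (h.and (((mk_lt_mk D).1 hac).and ((mk_lt_mk D).1 hcb))).exists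
  exact ht.2 h1 h2

variable [∀ t, Finite (L t)]

theorem infinite_Icc_iff {a b : ∀ t, L t} : (Set.Icc (mk D a) (mk D b)).Infinite ↔
    ∀ N : ℕ, ∀ᶠ t in (D : Filter ℕ), N ≤ (Set.Icc (a t) (b t)).ncard := by
  classical
  constructor
  · intro h N
    obtain ⟨s, hs, hsN⟩ := h.exists_subset_card_eq N
    choose γ hγ using mk_surjective (L := L) D
    have h1 : ∀ᶠ t in (D : Filter ℕ), ∀ z ∈ s, a t ≤ γ z t ∧ γ z t ≤ b t := by
      refine (Filter.eventually_all_finset s).2 fun z hz => ?_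
      have hz' := hs hz
      rw [← hγ z] at hz'
      exact ((mk_le_mk D).1 hz'.1).and ((mk_le_mk D).1 hz'.2)
    have h2 : ∀ᶠ t in (D : Filter ℕ), ∀ z ∈ s, ∀ z' ∈ s, z ≠ z' → γ z t ≠ γ z' t := by
      refine (Filter.eventually_all_finset s).2 fun z _ =>
        (Filter.eventually_all_finset s).2 fun z' _ => ?_
      by_cases hzz : z = z'
      · simp [hzz]
      · have : ¬ ∀ᶠ t in (D : Filter ℕ), γ z t = γ z' t := by
          rwa [← mk_eq_mk, hγ, hγ]
        exact (Ultrafilter.eventually_not.2 this).mono fun t ht _ => ht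
    filter_upwards [h1, h2] with t ht1 ht2
    have hinj : Set.InjOn (fun z => γ z t) (s : Set (Ultraproduct D L)) := by
      intro z hz z' hz' h
      by_contra hne
      exact ht2 z hz z' hz' hne h
    rw [← hsN, ← Set.ncard_coe_finset, ← hinj.ncard_image]
    refine Set.ncard_le_ncard ?_ (Set.toFinite _)
    rintro _ ⟨z, hz, rfl⟩
    exact ht1 z hz
  · intro h hfin
    set N := (Set.Icc (mk D a) (mk D b)).ncard + 1 with hN
    have hex : ∀ t, ∃ f : Fin N → L t, N ≤ (Set.Icc (a t) (b t)).ncard →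
        Function.Injective f ∧ ∀ i, f i ∈ Set.Icc (a t) (b t) := by
      intro t
      by_cases ht : N ≤ (Set.Icc (a t) (b t)).ncard
      · have hft : (Set.Icc (a t) (b t)).Finite := Set.toFinite _
        rw [Set.ncard_eq_toFinset_card _ hft] at ht
        refine ⟨fun i => hft.toFinset.orderEmbOfFin rfl (Fin.castLE ht i), fun _ =>
          ⟨fun i j hij => ?_, fun i => ?_⟩⟩
        · exact Fin.castLE_injective ht ((hft.toFinset.orderEmbOfFin rfl).injective hij)
        · have : hft.toFinset.orderEmbOfFin rfl (Fin.castLE ht i) ∈ hft.toFinset :=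
            Finset.orderEmbOfFin_mem _ _ _
          exact hft.mem_toFinset.1 this
      · exact ⟨fun _ => a t, fun h => absurd h ht⟩
    choose f hf using hex
    have hinj : Function.Injective fun i : Fin N => mk D fun t => f t i := by
      intro i j hij
      obtain ⟨t, ht, hij⟩ := ((h N).and ((mk_eq_mk D).1 hij)).exists
      exact (hf t ht).1 hij
    have hsub : Set.range (fun i : Fin N => mk D fun t => f t i) ⊆ Set.Icc (mk D a) (mk D b) := by
      rintro _ ⟨i, rfl⟩
      exact ⟨(mk_le_mk D).2 ((h N).mono fun t ht => ((hf t ht).2 i).1),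
        (mk_le_mk D).2 ((h N).mono fun t ht => ((hf t ht).2 i).2)⟩
    have := Set.ncard_le_ncard hsub hfin
    rw [← Set.image_univ, Set.ncard_image_of_injective _ hinj, Set.ncard_univ, Nat.card_fin] at this
    omega

-- If `D` were principal, the ultraproduct would embed in a single finite factor.
omit [∀ t, LinearOrder (L t)] in
theorem eventually_ge (hinf : Infinite (Ultraproduct D L)) (n : ℕ) : ∀ᶠ t in (D : Filter ℕ), n ≤ t := by
  rcases D.le_cofinite_or_eq_pure with h | ⟨t₀, h⟩
  · rw [Nat.cofinite_eq_atTop] at h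
    exact h (Filter.eventually_ge_atTop n)
  · exfalso
    choose γ hγ using mk_surjective (L := L) D
    have hinj : Function.Injective fun z => γ z t₀ := by
      intro z z' hz
      rw [← hγ z, ← hγ z', mk_eq_mk, h]
      exact hz
    exact (Finite.of_injective _ hinj).not_infinite hinf

omit [∀ t, LinearOrder (L t)] [∀ t, Finite (L t)] in
theorem nonempty_factor (hinf : Infinite (Ultraproduct D L)) (t : ℕ) : Nonempty (L t) := by
  obtain ⟨z⟩ : Nonempty (Ultraproduct D L) := inferInstance
  obtain ⟨a, -⟩ := mk_surjective D z
  exact ⟨a t⟩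

variable [Infinite (Ultraproduct D L)]

/-- The usual diagonal argument for `ℵ₁`-saturation: `P n` holds somewhere in almost every factor
because a sufficiently large interval has a middle point, and coordinate `t` uses the best solvable
`n ≤ t`. -/
theorem exists_infinite_Icc_Icc {a b : ℕ → ∀ t, L t}
    (h : ∀ i j, (Set.Icc (mk D (a i)) (mk D (b j))).Infinite) :
    ∃ x : ∀ t, L t, ∀ i, (Set.Icc (mk D (a i)) (mk D x)).Infinite ∧
      (Set.Icc (mk D x) (mk D (b i))).Infinite := by
  classical
  have hne := nonempty_factor D (L := L) inferInstance
  let P : ℕ → (t : ℕ) → L t → Prop := fun n t z =>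
    ∀ i ≤ n, n ≤ (Set.Icc (a i t) z).ncard ∧ n ≤ (Set.Icc z (b i t)).ncard
  have hP : ∀ n, ∀ᶠ t in (D : Filter ℕ), ∃ z, P n t z := by
    intro n
    have h1 : ∀ᶠ t in (D : Filter ℕ), ∀ i ∈ Finset.range (n + 1), ∀ j ∈ Finset.range (n + 1),
        2 * n + 1 ≤ (Set.Icc (a i t) (b j t)).ncard :=
      (Filter.eventually_all_finset _).2 fun i _ => (Filter.eventually_all_finset _).2
        fun j _ => (infinite_Icc_iff D).1 (h i j) _
    filter_upwards [h1] with t ht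
    have hr : (Finset.range (n + 1)).Nonempty := ⟨0, by simp⟩
    obtain ⟨i₀, hi₀, hi₀m⟩ := Finset.exists_max_image _ (fun i => a i t) hr
    obtain ⟨j₀, hj₀, hj₀m⟩ := Finset.exists_min_image _ (fun i => b i t) hr
    obtain ⟨z, hz1, hz2⟩ := exists_ncard_Icc_ge (ht i₀ hi₀ j₀ hj₀)
    refine ⟨z, fun i hi => ⟨hz1.trans ?_, hz2.trans ?_⟩⟩
    · exact Set.ncard_le_ncard (Set.Icc_subset_Icc_left
        (hi₀m i (Finset.mem_range.2 (by omega)))) (Set.toFinite _)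
    · exact Set.ncard_le_ncard (Set.Icc_subset_Icc_right
        (hj₀m i (Finset.mem_range.2 (by omega)))) (Set.toFinite _)
  have hx : ∀ t, ∃ x : L t, ∀ n ≤ t, (∃ z, P n t z) → P n t x := by
    intro t
    by_cases hg : ∃ n ≤ t, ∃ z, P n t z
    · obtain ⟨n, hnt, hn⟩ := hg
      -- `P n` implies `P m` for `m ≤ n`, so a solution for the greatest `n` solves all smaller
      -- cases.
      obtain ⟨x, hx⟩ := Nat.findGreatest_spec (P := fun n => ∃ z, P n t z) hnt hn
      refine ⟨x, fun m hmt hm i hi => ?_⟩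
      have hle := Nat.le_findGreatest (P := fun n => ∃ z, P n t z) hmt hm
      have := hx i (hi.trans hle)
      exact ⟨hle.trans this.1, hle.trans this.2⟩
    · obtain ⟨x⟩ := hne t
      exact ⟨x, fun n hn hz => (hg ⟨n, hn, hz⟩).elim⟩
  choose x hx using hx
  have hxP : ∀ n, ∀ᶠ t in (D : Filter ℕ), P n t (x t) := by
    intro n
    filter_upwards [hP n, eventually_ge D (L := L) inferInstance n] with t h1 h2
    exact hx t n h2 h1
  refine ⟨x, fun i => ⟨(infinite_Icc_iff D).2 fun N => ?_, (infinite_Icc_iff D).2 fun N => ?_⟩⟩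
  · filter_upwards [hxP (max i N)] with t ht
    exact (le_max_right i N).trans (ht i (le_max_left i N)).1
  · filter_upwards [hxP (max i N)] with t ht
    exact (le_max_right i N).trans (ht i (le_max_left i N)).2

theorem isPseudofiniteOrder : IsPseudofiniteOrder (Ultraproduct D L) where
  exists_bot := by
    have hne := nonempty_factor D (L := L) inferInstance
    have : ∀ t, ∃ b : L t, ∀ x, b ≤ x := fun t => Finite.exists_min id
    choose b hb using this
    refine ⟨mk D b, fun x => ?_⟩
    obtain ⟨x, rfl⟩ := mk_surjective D x
    exact Filter.Eventually.of_forall fun t => hb t (x t)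
  exists_top := by
    have hne := nonempty_factor D (L := L) inferInstance
    have : ∀ t, ∃ b : L t, ∀ x, x ≤ b := fun t => Finite.exists_max id
    choose b hb using this
    refine ⟨mk D b, fun x => ?_⟩
    obtain ⟨x, rfl⟩ := mk_surjective D x
    exact Filter.Eventually.of_forall fun t => hb t (x t)
  exists_covBy_right a c hac := by
    obtain ⟨a, rfl⟩ := mk_surjective D a
    obtain ⟨c, rfl⟩ := mk_surjective D c
    have : ∀ t, ∃ b : L t, a t < c t → a t ⋖ b := by
      intro t
      by_cases h : a t < c t
      · obtain ⟨b, hb⟩ := exists_covBy_of_wellFoundedLT (not_isMax_of_lt h)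
        exact ⟨b, fun _ => hb⟩
      · exact ⟨a t, fun h' => absurd h' h⟩
    choose b hb using this
    exact ⟨mk D b, mk_covBy_mk D (((mk_lt_mk D).1 hac).mono fun t ht => hb t ht)⟩
  exists_covBy_left a c hac := by
    obtain ⟨a, rfl⟩ := mk_surjective D a
    obtain ⟨c, rfl⟩ := mk_surjective D c
    have : ∀ t, ∃ b : L t, c t < a t → b ⋖ a t := by
      intro t
      by_cases h : c t < a t
      · obtain ⟨b, hb⟩ := exists_covBy_of_wellFoundedGT (not_isMin_of_lt h)
        exact ⟨b, fun _ => hb⟩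
      · exact ⟨a t, fun h' => absurd h' h⟩
    choose b hb using this
    exact ⟨mk D b, mk_covBy_mk D (((mk_lt_mk D).1 hac).mono fun t ht => hb t ht)⟩
  exists_infinite_Icc A B hA hB hAn hBn h := by
    obtain ⟨a, rfl⟩ := hA.exists_eq_range hAn
    obtain ⟨b, rfl⟩ := hB.exists_eq_range hBn
    choose γ hγ using mk_surjective (L := L) D
    obtain ⟨x, hx⟩ := exists_infinite_Icc_Icc D (a := fun i => γ (a i)) (b := fun i => γ (b i))
      fun i j => by
        rw [hγ, hγ]
        exact h _ ⟨i, rfl⟩ _ ⟨j, rfl⟩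
    simp only [hγ] at hx
    exact ⟨mk D x, by rintro _ ⟨i, rfl⟩; exact (hx i).1, by rintro _ ⟨i, rfl⟩; exact (hx i).2⟩

omit [∀ t, LinearOrder (L t)] [Infinite (Ultraproduct D L)] in
theorem mk_le_continuum : #(Ultraproduct D L) ≤ 𝔠 := by
  refine (Cardinal.mk_le_of_surjective (mk_surjective D)).trans ?_
  have : ∀ t, ∃ f : L t → ℕ, Function.Injective f := fun t => exists_injective_nat (L t)
  choose f hf using this
  have hinj : Function.Injective fun (a : ∀ t, L t) t => f t (a t) := fun a b hab =>
    funext fun t => hf t (congrFun hab t)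
  have h := Cardinal.lift_mk_le_lift_mk_of_injective hinj
  simpa using h

end Ultraproduct

/-! ### Decomposition into copies of `ℤ` -/

section FiniteIntervals

variable {M : Type u} [LinearOrder M]

/-- Two points are equivalent if the interval between them is finite. -/
def finiteIntervalSetoid (M : Type u) [LinearOrder M] : Setoid M where
  r x y := (Set.uIcc x y).Finite
  iseqv :=
    { refl := fun x => by simp
      symm := fun {x y} h => by rwa [Set.uIcc_comm]
      trans := fun {x y z} h h' => (h.union h').subset Set.uIcc_subset_uIcc_union_uIcc }

/-- The point `x` is infinitely far from both ends of the order. -/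
def IsInterior (x : M) : Prop := (Set.Iic x).Infinite ∧ (Set.Ici x).Infinite

theorem IsInterior.of_finite_uIcc {x y : M} (hx : IsInterior x) (h : (Set.uIcc x y).Finite) :
    IsInterior y := by
  refine ⟨fun hf => hx.1 ((hf.union h).subset fun z hz => ?_),
    fun hf => hx.2 ((hf.union h).subset fun z hz => ?_)⟩
  · rcases le_total z y with hzy | hzy
    · exact Or.inl hzy
    · exact Or.inr (Set.mem_uIcc.2 (Or.inr ⟨hzy, hz⟩))
  · rcases le_total y z with hzy | hzy
    · exact Or.inl hzy
    · exact Or.inr (Set.mem_uIcc.2 (Or.inl ⟨hz, hzy⟩))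

theorem finite_uIcc_trans {x y z : M} (h : (Set.uIcc x y).Finite) (h' : (Set.uIcc y z).Finite) :
    (Set.uIcc x z).Finite := (h.union h').subset Set.uIcc_subset_uIcc_union_uIcc

theorem CovBy.finite_uIcc {x y : M} (h : x ⋖ y) : (Set.uIcc x y).Finite := by
  rw [Set.uIcc_of_le h.le, h.Icc_eq]
  exact Set.toFinite _

/-- A set of representatives of the classes of interior points. -/
def interiorRepresentatives (M : Type u) [LinearOrder M] : Set M :=
  {r | IsInterior r ∧ (Quotient.mk (finiteIntervalSetoid M) r).out = r}

theorem exists_interiorRepresentative {x : M} (hx : IsInterior x) :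
    ∃ r ∈ interiorRepresentatives M, (Set.uIcc r x).Finite := by
  have h : (Set.uIcc (Quotient.mk (finiteIntervalSetoid M) x).out x).Finite :=
    Quotient.mk_out (s := finiteIntervalSetoid M) x
  refine ⟨_, ⟨hx.of_finite_uIcc ((finiteIntervalSetoid M).symm h), ?_⟩, h⟩
  rw [Quotient.out_eq]

theorem eq_of_mem_interiorRepresentatives {r r' : M} (hr : r ∈ interiorRepresentatives M)
    (hr' : r' ∈ interiorRepresentatives M) (h : (Set.uIcc r r').Finite) : r = r' := by
  rw [← hr.2, ← hr'.2, Quotient.sound (s := finiteIntervalSetoid M) h]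

theorem infinite_Icc_of_lt {r r' : M} (hr : r ∈ interiorRepresentatives M)
    (hr' : r' ∈ interiorRepresentatives M) (h : r < r') : (Set.Icc r r').Infinite := fun hf =>
  h.ne (eq_of_mem_interiorRepresentatives hr hr' (by rwa [Set.uIcc_of_le h.le]))

/-- Distinct representatives are infinitely far apart. Adding the least element to `A` and the
greatest to `B` forces the separating point to be interior, and its representative still separates.
-/
theorem IsPseudofiniteOrder.isEtaOne_interiorRepresentatives [Infinite M]
    (hM : IsPseudofiniteOrder M) : IsEtaOne (interiorRepresentatives M) := by
  intro A B hA hB hAB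
  obtain ⟨b₀, hb₀⟩ := hM.exists_bot
  obtain ⟨t₀, ht₀⟩ := hM.exists_top
  have hbI : ∀ x, Set.Icc b₀ x = Set.Iic x := fun x => Set.ext fun z => by simp [hb₀]
  have htI : ∀ x, Set.Icc x t₀ = Set.Ici x := fun x => Set.ext fun z => by simp [ht₀]
  have hI : Set.Iic t₀ = Set.univ := Set.ext fun z => by simp [ht₀]
  obtain ⟨x, hxA, hxB⟩ := hM.exists_infinite_Icc (insert b₀ (Subtype.val '' A))
    (insert t₀ (Subtype.val '' B)) ((hA.image _).insert _) ((hB.image _).insert _)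
    (Set.insert_nonempty _ _) (Set.insert_nonempty _ _) (by
      rintro a (rfl | ⟨a, ha, rfl⟩) b (rfl | ⟨b, hb, rfl⟩)
      · rw [hbI, hI]
        exact Set.infinite_univ
      · rw [hbI]
        exact b.2.1.1
      · rw [htI]
        exact a.2.1.2
      · exact infinite_Icc_of_lt a.2 b.2 (hAB a ha b hb))
  have hx : IsInterior x := ⟨hbI x ▸ hxA b₀ (Set.mem_insert _ _),
    htI x ▸ hxB t₀ (Set.mem_insert _ _)⟩
  obtain ⟨r, hr, hrx⟩ := exists_interiorRepresentative hx
  refine ⟨⟨r, hr⟩, fun a ha => ?_, fun b hb => ?_⟩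
  · by_contra hlt
    exact hxA a (Set.mem_insert_of_mem _ ⟨a, ha, rfl⟩) (hrx.subset fun z hz =>
      Set.mem_uIcc.2 (Or.inl ⟨(not_lt.1 hlt : r ≤ a).trans hz.1, hz.2⟩))
  · by_contra hlt
    exact hxB b (Set.mem_insert_of_mem _ ⟨b, hb, rfl⟩) (hrx.subset fun z hz =>
      Set.mem_uIcc.2 (Or.inr ⟨hz.1, hz.2.trans (not_lt.1 hlt : (b : M) ≤ r)⟩))

theorem IsPseudofiniteOrder.nonempty_orderIso_int (hM : IsPseudofiniteOrder M) {r : M}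
    (hr : IsInterior r) : Nonempty ({y : M // (Set.uIcc r y).Finite} ≃o ℤ) := by
  let C := {y : M // (Set.uIcc r y).Finite}
  have hIcc : ∀ a b : C, (Set.Icc a b).Finite := fun a b => by
    have h := finite_uIcc_trans ((finiteIntervalSetoid M).symm a.2) b.2
    refine Set.Finite.of_finite_image (f := Subtype.val) (h.subset ?_)
      Subtype.val_injective.injOn
    rintro _ ⟨z, hz, rfl⟩
    exact Set.mem_uIcc.2 (Or.inl ⟨hz.1, hz.2⟩)
  let _ : LocallyFiniteOrder C := LocallyFiniteOrder.ofFiniteIcc hIcc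
  have hmax : NoMaxOrder C := ⟨fun y => by
    obtain ⟨c, hc, hcy⟩ := (hr.of_finite_uIcc y.2).2.exists_notMem_finset {y.1}
    obtain ⟨b, hb⟩ := hM.exists_covBy_right y.1 c
      (lt_of_le_of_ne hc fun h => hcy (by simp [h]))
    exact ⟨⟨b, finite_uIcc_trans y.2 hb.finite_uIcc⟩, hb.lt⟩⟩
  have hmin : NoMinOrder C := ⟨fun y => by
    obtain ⟨c, hc, hcy⟩ := (hr.of_finite_uIcc y.2).1.exists_notMem_finset {y.1}
    obtain ⟨b, hb⟩ := hM.exists_covBy_left y.1 c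
      (lt_of_le_of_ne hc fun h => hcy (by simp [h]))
    exact ⟨⟨b, finite_uIcc_trans y.2 ((finiteIntervalSetoid M).symm hb.finite_uIcc)⟩, hb.lt⟩⟩
  have hne : Nonempty C := ⟨⟨r, (finiteIntervalSetoid M).refl r⟩⟩
  let _ : SuccOrder C := LinearLocallyFiniteOrder.succOrder C
  let _ : PredOrder C := LinearLocallyFiniteOrder.predOrder C
  exact ⟨orderIsoIntOfLinearSuccPredArch⟩

end FiniteIntervals

/-! ### The interior as a lexicographic product of `E` and `ℤ`, and its automorphisms. -/

section ChainSum

variable {M E : Type u} [LinearOrder M] [LinearOrder E]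

/-- The map `J` identifies the interior of `M` with the lexicographic product of `E` and `ℤ`. -/
structure IsChainSum (J : E → ℤ → M) : Prop where
  lt_iff : ∀ {e e' n n'}, J e n < J e' n' ↔ e < e' ∨ (e = e' ∧ n < n')
  exists_iff : ∀ {x}, (∃ e n, J e n = x) ↔ IsInterior x

theorem IsPseudofiniteOrder.exists_isChainSum [Infinite M] (hM : IsPseudofiniteOrder M)
    (hMc : #M ≤ ℵ₁) (hE : IsEtaOne E) (hEc : #E ≤ ℵ₁) : ∃ J : E → ℤ → M, IsChainSum J := by
  obtain ⟨ρ, -⟩ := IsPartialIso.exists_orderIso hE hM.isEtaOne_interiorRepresentatives hEc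
    ((Cardinal.mk_set_le _).trans hMc) (s := ∅) (by simp [IsPartialIso]) Set.countable_empty
  have hiso : ∀ e, Nonempty ({y : M // (Set.uIcc (ρ e).1 y).Finite} ≃o ℤ) := fun e =>
    hM.nonempty_orderIso_int (ρ e).2.1
  let ι : ∀ e, {y : M // (Set.uIcc (ρ e).1 y).Finite} ≃o ℤ := fun e => (hiso e).some
  let J : E → ℤ → M := fun e n => ((ι e).symm n).1
  have hJ : ∀ e n, (Set.uIcc (ρ e).1 (J e n)).Finite := fun e n => ((ι e).symm n).2
  have hlt : ∀ {e e'} n n', e < e' → J e n < J e' n' := by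
    intro e e' n n' h
    by_contra hle
    rw [not_lt] at hle
    have hinf := infinite_Icc_of_lt (ρ e).2 (ρ e').2 (ρ.lt_iff_lt.2 h)
    refine hinf (((hJ e n).union (hJ e' n')).subset fun z hz => ?_)
    rcases le_total z (J e n) with hz' | hz'
    · exact Or.inl (Set.mem_uIcc.2 (Or.inl ⟨hz.1, hz'⟩))
    · exact Or.inr (Set.mem_uIcc.2 (Or.inr ⟨hle.trans hz', hz.2⟩))
  have hlt' : ∀ e n n', J e n < J e n' ↔ n < n' := fun e n n' => (ι e).symm.lt_iff_lt
  refine ⟨J, fun {e e' n n'} => ?_, fun {x} => ⟨?_, fun hx => ?_⟩⟩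
  · rcases lt_trichotomy e e' with h | rfl | h
    · simp [h, hlt n n' h]
    · simp [hlt']
    · simp [h.not_gt, h.ne', (hlt n' n h).not_gt]
  · rintro ⟨e, n, rfl⟩
    exact (ρ e).2.1.of_finite_uIcc (hJ e n)
  · obtain ⟨r, hr, hrx⟩ := exists_interiorRepresentative hx
    obtain ⟨e, he⟩ := ρ.surjective ⟨r, hr⟩
    have hx' : (Set.uIcc (ρ e).1 x).Finite := by rwa [he]
    exact ⟨e, ι e ⟨x, hx'⟩, by simp [J]⟩

namespace IsChainSum

variable {J : E → ℤ → M} (hJ : IsChainSum J)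
include hJ

theorem eq_iff {e e' : E} {n n' : ℤ} : J e n = J e' n' ↔ e = e' ∧ n = n' := by
  refine ⟨fun h => ?_, by rintro ⟨rfl, rfl⟩; rfl⟩
  have h1 := (hJ.lt_iff (e := e) (e' := e') (n := n) (n' := n')).not.1 h.not_lt
  have h2 := (hJ.lt_iff (e := e') (e' := e) (n := n') (n' := n)).not.1 h.not_gt
  rcases lt_trichotomy e e' with he | rfl | he
  · exact (h1 (Or.inl he)).elim
  · refine ⟨rfl, le_antisymm ?_ ?_⟩
    · exact not_lt.1 fun hn => h2 (Or.inr ⟨rfl, hn⟩)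
    · exact not_lt.1 fun hn => h1 (Or.inr ⟨rfl, hn⟩)
  · exact (h2 (Or.inl he)).elim

theorem isInterior (e : E) (n : ℤ) : IsInterior (J e n) := hJ.exists_iff.1 ⟨e, n, rfl⟩

theorem covBy (e : E) (n : ℤ) : J e n ⋖ J e (n + 1) := by
  refine ⟨hJ.lt_iff.2 (Or.inr ⟨rfl, by omega⟩), fun z hz hz' => ?_⟩
  obtain ⟨e', m, rfl⟩ := hJ.exists_iff.2
    ⟨(hJ.isInterior e n).1.mono (Set.Iic_subset_Iic.2 hz.le),
      (hJ.isInterior e (n + 1)).2.mono (Set.Ici_subset_Ici.2 hz'.le)⟩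
  rw [hJ.lt_iff] at hz hz'
  rcases hz with hz | ⟨rfl, hz⟩
  · rcases hz' with hz' | ⟨rfl, hz'⟩
    · exact lt_asymm hz hz'
    · exact lt_irrefl _ hz
  · rcases hz' with hz' | ⟨-, hz'⟩
    · exact lt_irrefl _ hz'
    · omega

end IsChainSum

theorem isInterior_apply {θ : Aut M} {x : M} : IsInterior (θ x) ↔ IsInterior x := by
  rw [IsInterior, ← θ.image_Iic, ← θ.image_Ici, Set.infinite_image_iff θ.injective.injOn,
    Set.infinite_image_iff θ.injective.injOn, IsInterior]

/-- An automorphism preserves the number of predecessors and of successors, and a finite such number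
determines the point. -/
theorem apply_eq_of_not_isInterior {x : M} (hx : ¬ IsInterior x) (θ : Aut M) : θ x = x := by
  rw [IsInterior, not_and_or, Set.not_infinite, Set.not_infinite] at hx
  rcases hx with hx | hx
  · have hc : (Set.Iic (θ x)).ncard = (Set.Iic x).ncard := by
      rw [← θ.image_Iic, Set.ncard_image_of_injective _ θ.injective]
    have hx' : (Set.Iic (θ x)).Finite := by
      rw [← θ.image_Iic]
      exact hx.image _
    rcases le_total (θ x) x with h | h
    · exact Set.Iic_injective (Set.eq_of_subset_of_ncard_le (Set.Iic_subset_Iic.2 h) hc.ge hx)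
    · exact (Set.Iic_injective
        (Set.eq_of_subset_of_ncard_le (Set.Iic_subset_Iic.2 h) hc.le hx')).symm
  · have hc : (Set.Ici (θ x)).ncard = (Set.Ici x).ncard := by
      rw [← θ.image_Ici, Set.ncard_image_of_injective _ θ.injective]
    have hx' : (Set.Ici (θ x)).Finite := by
      rw [← θ.image_Ici]
      exact hx.image _
    rcases le_total x (θ x) with h | h
    · exact Set.Ici_injective (Set.eq_of_subset_of_ncard_le (Set.Ici_subset_Ici.2 h) hc.ge hx)
    · exact (Set.Ici_injective
        (Set.eq_of_subset_of_ncard_le (Set.Ici_subset_Ici.2 h) hc.le hx')).symm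

/-! ### The action of the semidirect product -/

open Classical in
/-- The element `(k, φ)` of the semidirect product maps the point with index `(e, n)` to the point
with index `(φ e, n + k (φ e))`, and fixes the points outside the range of `J`. -/
noncomputable def chainSumMap (J : E → ℤ → M)
    (a : (E → Multiplicative ℤ) ⋊[permuteCoordinates E] Aut E) (x : M) : M :=
  if h : ∃ p : E × ℤ, J p.1 p.2 = x then
    J (a.right h.choose.1) (h.choose.2 + (a.left (a.right h.choose.1)).toAdd)
  else x

namespace IsChainSum

variable {J : E → ℤ → M} (hJ : IsChainSum J)

include hJ

theorem map_apply (a : (E → Multiplicative ℤ) ⋊[permuteCoordinates E] Aut E) (e : E) (n : ℤ) :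
    chainSumMap J a (J e n) = J (a.right e) (n + (a.left (a.right e)).toAdd) := by
  have h : ∃ p : E × ℤ, J p.1 p.2 = J e n := ⟨(e, n), rfl⟩
  obtain ⟨h1, h2⟩ := hJ.eq_iff.1 h.choose_spec
  rw [chainSumMap, dif_pos h, h1, h2]

theorem map_of_not_isInterior (a : (E → Multiplicative ℤ) ⋊[permuteCoordinates E] Aut E) {x : M}
    (hx : ¬ IsInterior x) : chainSumMap J a x = x := by
  rw [chainSumMap, dif_neg]
  rintro ⟨p, hp⟩
  exact hx (hJ.exists_iff.1 ⟨p.1, p.2, hp⟩)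

theorem map_one (x : M) : chainSumMap J 1 x = x := by
  by_cases hx : IsInterior x
  · obtain ⟨e, n, rfl⟩ := hJ.exists_iff.2 hx
    rw [hJ.map_apply]
    exact congrArg (J e) (add_zero n)
  · exact hJ.map_of_not_isInterior 1 hx

theorem map_mul (a b : (E → Multiplicative ℤ) ⋊[permuteCoordinates E] Aut E) (x : M) :
    chainSumMap J (a * b) x = chainSumMap J a (chainSumMap J b x) := by
  by_cases hx : IsInterior x
  · obtain ⟨e, n, rfl⟩ := hJ.exists_iff.2 hx
    rw [hJ.map_apply, hJ.map_apply, hJ.map_apply]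
    have h1 : (a * b).right e = a.right (b.right e) := rfl
    have h2 : (a * b).left (a.right (b.right e)) =
        a.left (a.right (b.right e)) * b.left (a.right.symm (a.right (b.right e))) := rfl
    rw [h1, h2, OrderIso.symm_apply_apply, toAdd_mul, add_assoc,
      add_comm (Multiplicative.toAdd (b.left _))]
  · rw [hJ.map_of_not_isInterior _ hx, hJ.map_of_not_isInterior _ hx,
      hJ.map_of_not_isInterior _ hx]

theorem strictMono_map (a : (E → Multiplicative ℤ) ⋊[permuteCoordinates E] Aut E) :
    StrictMono (chainSumMap J a) := by
  intro x y hxy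
  by_cases hx : IsInterior x
  · obtain ⟨e, n, rfl⟩ := hJ.exists_iff.2 hx
    by_cases hy : IsInterior y
    · obtain ⟨e', n', rfl⟩ := hJ.exists_iff.2 hy
      rw [hJ.map_apply, hJ.map_apply, hJ.lt_iff]
      rcases hJ.lt_iff.1 hxy with h | ⟨rfl, h⟩
      · exact Or.inl (a.right.lt_iff_lt.2 h)
      · exact Or.inr ⟨rfl, by omega⟩
    · rw [hJ.map_of_not_isInterior a hy, hJ.map_apply]
      by_contra hle
      exact hy ⟨hx.1.mono (Set.Iic_subset_Iic.2 hxy.le),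
        (hJ.isInterior _ _).2.mono (Set.Ici_subset_Ici.2 (not_lt.1 hle))⟩
  · rw [hJ.map_of_not_isInterior a hx]
    by_cases hy : IsInterior y
    · obtain ⟨e', n', rfl⟩ := hJ.exists_iff.2 hy
      rw [hJ.map_apply]
      by_contra hle
      exact hx ⟨(hJ.isInterior _ _).1.mono (Set.Iic_subset_Iic.2 (not_lt.1 hle)),
        hy.2.mono (Set.Ici_subset_Ici.2 hxy.le)⟩
    · rwa [hJ.map_of_not_isInterior a hy]

/-- The action of the semidirect product on `M`. -/
noncomputable def toAut : (E → Multiplicative ℤ) ⋊[permuteCoordinates E] Aut E →* Aut M where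
  toFun a :=
    { toFun := chainSumMap J a
      invFun := chainSumMap J a⁻¹
      left_inv := fun x => by rw [← hJ.map_mul, inv_mul_cancel, hJ.map_one]
      right_inv := fun x => by rw [← hJ.map_mul, mul_inv_cancel, hJ.map_one]
      map_rel_iff' := (hJ.strictMono_map a).le_iff_le }
  map_one' := by
    ext x
    exact hJ.map_one x
  map_mul' a b := by
    ext x
    exact hJ.map_mul a b x

theorem toAut_apply (a : (E → Multiplicative ℤ) ⋊[permuteCoordinates E] Aut E) (e : E) (n : ℤ) :
    hJ.toAut a (J e n) = J (a.right e) (n + (a.left (a.right e)).toAdd) := hJ.map_apply a e n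

/-- One value on each chain records the image chain and the shift. This gives injectivity, and
continuity of the inverse. -/
theorem toAut_eq_iff {a b : (E → Multiplicative ℤ) ⋊[permuteCoordinates E] Aut E} {e : E} :
    hJ.toAut a (J e 0) = hJ.toAut b (J e 0) ↔
      a.right e = b.right e ∧ a.left (a.right e) = b.left (a.right e) := by
  rw [hJ.toAut_apply, hJ.toAut_apply, hJ.eq_iff]
  refine and_congr_right fun h => ?_
  rw [← h, zero_add, zero_add]
  exact Multiplicative.toAdd.injective.eq_iff

theorem toAut_injective : Function.Injective hJ.toAut := by
  intro a b hab
  have h := fun e => hJ.toAut_eq_iff.1 (congrArg (fun θ : Aut M => θ (J e 0)) hab)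
  refine SemidirectProduct.ext (funext fun e => ?_) (OrderIso.ext (funext fun e => (h e).1))
  simpa using (h (a.right.symm e)).2

theorem apply_eq_of_apply_zero {θ : Aut M} {e e' : E} {m : ℤ} (h : θ (J e 0) = J e' m) (n : ℤ) :
    θ (J e n) = J e' (n + m) := by
  induction n using Int.induction_on with
  | zero => rw [h, zero_add]
  | succ n ih =>
    have h1 : θ (J e n) ⋖ θ (J e (n + 1)) := (apply_covBy_apply_iff θ).2 (hJ.covBy e n)
    rw [ih] at h1
    rw [h1.unique_right (hJ.covBy _ _), add_right_comm]
  | pred n ih =>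
    have h1 : θ (J e (-n - 1)) ⋖ θ (J e (-n - 1 + 1)) :=
      (apply_covBy_apply_iff θ).2 (hJ.covBy e _)
    rw [sub_add_cancel, ih] at h1
    have h2 := hJ.covBy e' (-n - 1 + m)
    rw [show (-n - 1 + m + 1 : ℤ) = -n + m by ring] at h2
    exact h1.unique_left h2

theorem toAut_surjective : Function.Surjective hJ.toAut := by
  intro θ
  have hex : ∀ e, ∃ e' m, J e' m = θ (J e 0) := fun e =>
    hJ.exists_iff.2 (isInterior_apply.2 (hJ.isInterior e 0))
  choose φ g hφ using hex
  have hθ : ∀ e n, θ (J e n) = J (φ e) (n + g e) := fun e =>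
    hJ.apply_eq_of_apply_zero (hφ e).symm
  have hmono : StrictMono φ := by
    intro e e' h
    -- The index `g e' - g e` gives both images the same `ℤ`-coordinate `g e'`, so the strict
    -- inequality must come from `φ e < φ e'`.
    have h1 : θ (J e (g e' - g e)) < θ (J e' 0) := θ.lt_iff_lt.2 (hJ.lt_iff.2 (Or.inl h))
    rw [hθ, hθ, hJ.lt_iff] at h1
    rcases h1 with h1 | ⟨-, h1⟩
    · exact h1
    · omega
  have hsurj : Function.Surjective φ := by
    intro e'
    obtain ⟨e, n, h⟩ := hJ.exists_iff.2
      ((isInterior_apply (θ := θ.symm)).2 (hJ.isInterior e' 0))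
    refine ⟨e, ?_⟩
    have h1 := hθ e n
    rw [h, OrderIso.apply_symm_apply, hJ.eq_iff] at h1
    exact h1.1.symm
  let φ' : Aut E := hmono.orderIsoOfSurjective φ hsurj
  refine ⟨⟨fun e => Multiplicative.ofAdd (g (φ'.symm e)), φ'⟩, ?_⟩
  ext x
  by_cases hx : IsInterior x
  · obtain ⟨e, n, rfl⟩ := hJ.exists_iff.2 hx
    rw [hJ.toAut_apply, hθ]
    change J (φ' e) (n + g (φ'.symm (φ' e))) = _
    rw [OrderIso.symm_apply_apply]
    rfl
  · rw [apply_eq_of_not_isInterior hx, apply_eq_of_not_isInterior hx]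

theorem continuous_toAut : Continuous hJ.toAut := by
  refine continuous_induced_rng.2 (@continuous_pi _ _ _ _ (fun _ => ⊥) _ fun x => ?_)
  let _ : TopologicalSpace M := ⊥
  refine continuous_iff_continuousAt.2 fun a => ?_
  refine (continuousAt_const (y := hJ.toAut a x)).congr ?_
  by_cases hx : IsInterior x
  · obtain ⟨e, n, rfl⟩ := hJ.exists_iff.2 hx
    have hc : Continuous fun b : (E → Multiplicative ℤ) ⋊[permuteCoordinates E] Aut E =>
      (b.left, b.right) := continuous_induced_dom
    have h1 := (hc.snd.tendsto a).eventually (eventually_apply_eq a.right e)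
    have h2 : ∀ᶠ b : (E → Multiplicative ℤ) ⋊[permuteCoordinates E] Aut E in 𝓝 a,
        b.left (a.right e) = a.left (a.right e) :=
      (((continuous_apply (a.right e)).comp hc.fst).tendsto a).eventually
        ((isOpen_discrete {a.left (a.right e)}).mem_nhds rfl)
    filter_upwards [h1, h2] with b hb1 hb2
    change hJ.toAut a (J e n) = hJ.toAut b (J e n)
    rw [hJ.toAut_apply, hJ.toAut_apply, hb1, hb2]
  · refine Filter.Eventually.of_forall fun b => ?_
    change hJ.toAut a x = hJ.toAut b x
    rw [apply_eq_of_not_isInterior hx, apply_eq_of_not_isInterior hx]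

/-- The automorphism group of a sum of copies of `ℤ` along `E`. -/
noncomputable def autEquiv :
    Aut M ≃ₜ* ((E → Multiplicative ℤ) ⋊[permuteCoordinates E] Aut E) :=
  ContinuousMulEquiv.symm
    { MulEquiv.ofBijective hJ.toAut ⟨hJ.toAut_injective, hJ.toAut_surjective⟩ with
      continuous_toFun := hJ.continuous_toAut
      continuous_invFun := by
        let Ψ := MulEquiv.ofBijective hJ.toAut ⟨hJ.toAut_injective, hJ.toAut_surjective⟩
        have key : ∀ (θ : Aut M) (e : E), ∀ᶠ η in 𝓝 θ,
            (Ψ.symm η).right e = (Ψ.symm θ).right e ∧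
              (Ψ.symm η).left ((Ψ.symm θ).right e) = (Ψ.symm θ).left ((Ψ.symm θ).right e) := by
          intro θ e
          filter_upwards [eventually_apply_eq θ (J e 0)] with η hη
          have h : hJ.toAut (Ψ.symm η) (J e 0) = hJ.toAut (Ψ.symm θ) (J e 0) := by
            change Ψ (Ψ.symm η) (J e 0) = Ψ (Ψ.symm θ) (J e 0)
            rw [MulEquiv.apply_symm_apply, MulEquiv.apply_symm_apply, hη]
          obtain ⟨h1, h2⟩ := hJ.toAut_eq_iff.1 h
          exact ⟨h1, h1 ▸ h2⟩
        change Continuous Ψ.symm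
        refine continuous_induced_rng.2 (Continuous.prodMk (continuous_pi fun e => ?_)
          (continuous_induced_rng.2 (@continuous_pi _ _ _ _ (fun _ => ⊥) _ fun e => ?_)))
        · refine continuous_iff_continuousAt.2 fun θ => ?_
          refine (continuousAt_const (y := (Ψ.symm θ).left e)).congr ?_
          filter_upwards [key θ ((Ψ.symm θ).right.symm e)] with η hη
          have h := hη.2
          rw [OrderIso.apply_symm_apply] at h
          exact h.symm
        · let _ : TopologicalSpace E := ⊥
          refine continuous_iff_continuousAt.2 fun θ => ?_
          refine (continuousAt_const (y := (Ψ.symm θ).right e)).congr ?_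
          filter_upwards [key θ e] with η hη
          exact hη.1.symm }

end IsChainSum

end ChainSum

end PseudofiniteOrder

theorem mainTheorem8
    (hCH : (𝔠 : Cardinal.{0}) = ℵ₁)
    (D : Ultrafilter ℕ) (L : ℕ → Type u) [∀ t, LinearOrder (L t)] [∀ t, Finite (L t)]
    [Infinite (Ultraproduct D L)]
    (E : Type u) [LinearOrder E] [Nonempty E] [DenselyOrdered E] [NoMinOrder E] [NoMaxOrder E]
    (hEsat : IsSaturatedOrder ℵ₁ E) (hEcard : #E = ℵ₁) :
    #E = 𝔠 ∧
    ∃ Φ : Aut (Ultraproduct D L) ≃ₜ* ((E → Multiplicative ℤ) ⋊[permuteCoordinates E] Aut E),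
      (∃ (X : Type u) (_ : TopologicalSpace X) (_ : MulAction (Aut (Ultraproduct D L)) X),
        IsUniversalMinimalFlow (Aut (Ultraproduct D L)) X) ∧
      (∃ (Y : Type u) (_ : TopologicalSpace Y) (_ : MulAction (E → Multiplicative ℤ) Y),
        IsUniversalMinimalFlow (E → Multiplicative ℤ) Y) ∧
      ∀ (X : Type u) [TopologicalSpace X] [MulAction (Aut (Ultraproduct D L)) X]
        (Y : Type u) [TopologicalSpace Y] [MulAction (E → Multiplicative ℤ) Y],
        IsUniversalMinimalFlow (Aut (Ultraproduct D L)) X →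
        IsUniversalMinimalFlow (E → Multiplicative ℤ) Y →
        ∃ F : X ≃ₜ Y, ∀ (k : E → Multiplicative ℤ) (x : X),
          F (Φ.symm (SemidirectProduct.inl k) • x) = k • F x := by
  -- The Continuum Hypothesis is assumed in universe `0` and lifted to the universe of the orders.
  have hCH' : (𝔠 : Cardinal.{u}) = ℵ₁ := by
    simpa using congrArg Cardinal.lift.{u} hCH
  have hE : IsEtaOne E := hEsat.isEtaOne
  obtain ⟨J, hJ⟩ := (Ultraproduct.isPseudofiniteOrder (L := L) D).exists_isChainSum
    ((Ultraproduct.mk_le_continuum D).trans hCH'.le) hE hEcard.le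
  exact ⟨hEcard.trans hCH'.symm, hJ.autEquiv,
    universalMinimalFlow_homeomorph hE hEcard.le hJ.autEquiv⟩
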